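/- Let $(M,\omega)$ be a symplectic manifold of dimension $2n$, that is, a smooth manifold $M$ (Hausdorff, second countable) with a smooth closed non-degenerate 2-form $\omega$. For a smooth function $h$ on $M$ let $\mathbb X_h$ be its Hamiltonian vector field, determined by $\omega(\mathbb X_h,Y)=\mathrm dh(Y)$ for every vector field $Y$. Let $B$ be a connected open subset of $\mathbb R^n$ and let $f=(f_1,\dots,f_n)\colon M\to B$ be a smooth fiber bundle. Suppose that - $H^2(B;\mathbb R)=0$ (de Rham cohomology: closed smooth 2-forms on $B$ modulo exact ones), - each fiber $f^{-1}(b)$, $b\in B$, is a simply connected Lagrangian submanifold of $M$, and - the Hamiltonian vector fields $\mathbb X_{f_1},\dots,\mathbb X_{f_n}$ are linearly independent at each point of $M$ and complete. Then there is a function $g=(g_1,\dots,g_n)\colon M\to\mathbb R^n$ such that $(f_1,\dots,f_n,g_1,\dots,g_n)$ is a global Darboux coordinate system, that is, $(f,g)\colon M\to\mathbb R^{2n}$ is a diffeomorphism onto an open subset of $\mathbb R^{2n}$ and $\omega=\sum_{i=1}^n \mathrm df_i\wedge \mathrm dg_i$ on $M$. -/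

import Mathlib

open scoped Manifold ContDiff

noncomputable section

/-- The vector space `ℝᵐ`. -/
abbrev RSpace (m : ℕ) : Type := EuclideanSpace ℝ (Fin m)

/-! ### De Rham cohomology of an open subset of `ℝᵐ` -/

namespace DeRham

variable {m : ℕ}

/-- The smooth closed `k`-forms on the open set `U`. A form on `U` is represented by a function on
`ℝᵐ` whose values outside `U` are irrelevant: they are killed in the cohomology below. -/
def closedForms (k : ℕ) (U : TopologicalSpace.Opens (RSpace m)) :
    Submodule ℝ (RSpace m → RSpace m [⋀^Fin k]→L[ℝ] ℝ) where
  carrier := {α | ContDiffOn ℝ ∞ α U ∧ ∀ x ∈ U, extDeriv α x = 0}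
  zero_mem' := ⟨contDiffOn_const, fun x _ ↦ by
    have h := extDeriv_smul (0 : ℝ) (0 : RSpace m → RSpace m [⋀^Fin k]→L[ℝ] ℝ) (x := x)
    simpa using h⟩
  add_mem' := by
    rintro α β ⟨hα, hα'⟩ ⟨hβ, hβ'⟩
    refine ⟨hα.add hβ, fun x hx ↦ ?_⟩
    have hU := U.isOpen.mem_nhds hx
    rw [extDeriv_add ((hα.contDiffAt hU).differentiableAt (by simp))
      ((hβ.contDiffAt hU).differentiableAt (by simp)), hα' x hx, hβ' x hx, add_zero]
  smul_mem' := by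
    rintro c α ⟨hα, hα'⟩
    refine ⟨contDiffOn_const.smul hα, fun x hx ↦ ?_⟩
    rw [extDeriv_smul, hα' x hx, smul_zero]

/-- The `k`-forms on the open set `U` that are exact: those that vanish on `U` if `k = 0`, and the
exterior derivatives of smooth `(k - 1)`-forms on `U` if `k > 0`. -/
def exactForms : ∀ (k : ℕ) (_ : TopologicalSpace.Opens (RSpace m)),
    Submodule ℝ (RSpace m → RSpace m [⋀^Fin k]→L[ℝ] ℝ)
  | 0, U =>
    { carrier := {α : RSpace m → RSpace m [⋀^Fin 0]→L[ℝ] ℝ | ∀ x ∈ U, α x = 0}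
      zero_mem' := fun _ _ ↦ rfl
      add_mem' := fun {α β} hα hβ x hx ↦ by simp [hα x hx, hβ x hx]
      smul_mem' := fun c α hα x hx ↦ by simp [hα x hx] }
  | k + 1, U =>
    { carrier := {α | ∃ β : RSpace m → RSpace m [⋀^Fin k]→L[ℝ] ℝ,
        ContDiffOn ℝ ∞ β U ∧ ∀ x ∈ U, α x = extDeriv β x}
      zero_mem' := ⟨0, contDiffOn_const, fun x _ ↦ by
        have h := extDeriv_smul (0 : ℝ) (0 : RSpace m → RSpace m [⋀^Fin k]→L[ℝ] ℝ) (x := x)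
        simpa using h.symm⟩
      add_mem' := by
        rintro α β ⟨α', hα', hα⟩ ⟨β', hβ', hβ⟩
        refine ⟨α' + β', hα'.add hβ', fun x hx ↦ ?_⟩
        have hU := U.isOpen.mem_nhds hx
        rw [extDeriv_add ((hα'.contDiffAt hU).differentiableAt (by simp))
          ((hβ'.contDiffAt hU).differentiableAt (by simp)), Pi.add_apply, hα x hx, hβ x hx]
      smul_mem' := by
        rintro c α ⟨α', hα', hα⟩
        refine ⟨c • α', contDiffOn_const.smul hα', fun x hx ↦ ?_⟩
        rw [extDeriv_smul, Pi.smul_apply, hα x hx] }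

/-- The `k`-th cohomology `H^k(U; ℝ)` of the open set `U`: closed forms modulo exact forms in the
complex of smooth differential forms on `U`. -/
abbrev cohomology (k : ℕ) (U : TopologicalSpace.Opens (RSpace m)) : Type :=
  closedForms k U ⧸ ((exactForms k U).submoduleOf (closedForms k U)).toAddSubgroup

end DeRham

/-! ### Symplectic forms and Hamiltonian vector fields -/

namespace Symplectic

variable {m : ℕ} {M : Type*} [TopologicalSpace M] [ChartedSpace (RSpace m) M]

variable (m M) in
/-- A (not necessarily smooth) differential 2-form on `M`. -/
abbrev TwoForm : Type _ := ∀ x : M, TangentSpace (𝓡 m) x [⋀^Fin 2]→L[ℝ] ℝ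

/-- The expression of a 2-form in the chart at `x₀`: its pullback by the inverse of the chart. -/
def chartForm (Ω : TwoForm m M) (x₀ : M) (z : RSpace m) : RSpace m [⋀^Fin 2]→L[ℝ] ℝ :=
  (Ω ((extChartAt (𝓡 m) x₀).symm z)).compContinuousLinearMap
    (mfderiv 𝓘(ℝ, RSpace m) (𝓡 m) (extChartAt (𝓡 m) x₀).symm z)

/-- A symplectic form: a smooth, closed and non-degenerate 2-form. -/
structure IsSymplecticForm (Ω : TwoForm m M) : Prop where
  smooth : ∀ x₀ : M, ContDiffOn ℝ ∞ (chartForm Ω x₀) (extChartAt (𝓡 m) x₀).target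
  closed : ∀ x₀ : M, ∀ z ∈ (extChartAt (𝓡 m) x₀).target, extDeriv (chartForm Ω x₀) z = 0
  nondegenerate : ∀ (x : M) (v : TangentSpace (𝓡 m) x),
    (∀ w : TangentSpace (𝓡 m) x, Ω x ![v, w] = 0) → v = 0

/-- The differential of a real function at a point, as a linear form on the tangent space. -/
def differential (h : M → ℝ) (x : M) : TangentSpace (𝓡 m) x →L[ℝ] ℝ :=
  mfderiv (𝓡 m) 𝓘(ℝ, ℝ) h x

open Classical in
/-- The Hamiltonian vector field of `h`: the vector field `X` with `Ω (X, Y) = dh (Y)` for every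
`Y`, which exists and is unique if `Ω` is non-degenerate; see `hamiltonianVectorField_spec` and
`eq_hamiltonianVectorField`. -/
def hamiltonianVectorField (Ω : TwoForm m M) (h : M → ℝ) (x : M) : TangentSpace (𝓡 m) x :=
  if H : ∃ v : TangentSpace (𝓡 m) x, ∀ w, Ω x ![v, w] = differential h x w then H.choose else 0

/-- A non-degenerate alternating form represents every linear form. -/
theorem exists_eq_of_nondegenerate {V : Type*} [AddCommGroup V] [Module ℝ V] [TopologicalSpace V]
    [FiniteDimensional ℝ V] (q : V [⋀^Fin 2]→L[ℝ] ℝ) (hq : ∀ v, (∀ w, q ![v, w] = 0) → v = 0)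
    (l : V →ₗ[ℝ] ℝ) : ∃ v, ∀ w, q ![v, w] = l w := by
  have h2 (v w u : V) : Function.update ![v, w] 1 u = ![v, u] := by
    ext j; fin_cases j <;> rfl
  let flat : V →ₗ[ℝ] (V →ₗ[ℝ] ℝ) := LinearMap.mk₂ ℝ (fun v w ↦ q ![v, w])
    (fun v v' w ↦ q.toContinuousMultilinearMap.cons_add ![w] v v')
    (fun c v w ↦ q.toContinuousMultilinearMap.cons_smul ![w] c v)
    (fun v w w' ↦ by simpa only [h2] using q.map_update_add ![v, w] 1 w w')
    (fun c v w ↦ by simpa only [h2] using q.map_update_smul ![v, w] 1 c w)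
  have hinj : Function.Injective flat := by
    rw [← LinearMap.ker_eq_bot, LinearMap.ker_eq_bot']
    exact fun v hv ↦ hq v fun w ↦ LinearMap.congr_fun hv w
  obtain ⟨v, hv⟩ := (LinearMap.injective_iff_surjective_of_finrank_eq_finrank
    (Subspace.dual_finrank_eq (K := ℝ) (V := V)).symm).1 hinj l
  exact ⟨v, fun w ↦ LinearMap.congr_fun hv w⟩

theorem exists_hamiltonianVector {Ω : TwoForm m M} (hΩ : IsSymplecticForm Ω) (h : M → ℝ) (x : M) :
    ∃ v : TangentSpace (𝓡 m) x, ∀ w, Ω x ![v, w] = differential h x w :=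
  haveI : FiniteDimensional ℝ (TangentSpace (𝓡 m) x) :=
    inferInstanceAs (FiniteDimensional ℝ (RSpace m))
  exists_eq_of_nondegenerate (Ω x) (hΩ.nondegenerate x) (differential h x).toLinearMap

theorem hamiltonianVectorField_spec {Ω : TwoForm m M} (hΩ : IsSymplecticForm Ω) (h : M → ℝ)
    (x : M) (w : TangentSpace (𝓡 m) x) :
    Ω x ![hamiltonianVectorField Ω h x, w] = differential h x w := by
  have H := exists_hamiltonianVector hΩ h x
  rw [hamiltonianVectorField, dif_pos H]
  exact H.choose_spec w

theorem eq_hamiltonianVectorField {Ω : TwoForm m M} (hΩ : IsSymplecticForm Ω) (h : M → ℝ)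
    (x : M) (v : TangentSpace (𝓡 m) x) (hv : ∀ w, Ω x ![v, w] = differential h x w) :
    v = hamiltonianVectorField Ω h x := by
  refine sub_eq_zero.1 (hΩ.nondegenerate x _ fun w ↦ ?_)
  have key := ContinuousMultilinearMap.cons_add
    (Ω x).toContinuousMultilinearMap ![w] (v - hamiltonianVectorField Ω h x)
      (hamiltonianVectorField Ω h x)
  rw [sub_add_cancel] at key
  have h1 : Ω x ![v, w] = Ω x ![v - hamiltonianVectorField Ω h x, w]
    + Ω x ![hamiltonianVectorField Ω h x, w] := key
  rw [hv, hamiltonianVectorField_spec hΩ] at h1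
  linarith

/-- A vector field is complete if a global integral curve passes through each point. -/
def IsCompleteVectorField (X : ∀ x : M, TangentSpace (𝓡 m) x) : Prop :=
  ∀ x : M, ∃ γ : ℝ → M, γ 0 = x ∧ IsMIntegralCurve (I := 𝓡 m) γ X

/-- A subspace of a tangent space is Lagrangian if it equals its `Ω`-orthogonal complement. -/
def IsLagrangianSubspace (Ω : TwoForm m M) (x : M)
    (L : Submodule ℝ (TangentSpace (𝓡 m) x)) : Prop :=
  ∀ v : TangentSpace (𝓡 m) x, v ∈ L ↔ ∀ w ∈ L, Ω x ![v, w] = 0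

/-- `f : M → B ⊆ ℝⁿ` is a smooth fiber bundle over the open set `B` with typical fiber the smooth
manifold `F`: it is smooth, with values in `B`, and over a neighborhood of each point of `B`
there is a local trivialization that is a diffeomorphism. -/
structure IsSmoothFiberBundle {n : ℕ} (k : ℕ) (F : Type*) [TopologicalSpace F]
    [ChartedSpace (RSpace k) F] (f : M → RSpace n) (B : TopologicalSpace.Opens (RSpace n)) :
    Prop where
  contMDiff : ContMDiff (𝓡 m) (𝓡 n) ∞ f
  mapsTo : ∀ x : M, f x ∈ B
  locallyTrivial : ∀ b ∈ B, ∃ e : Bundle.Trivialization F f, b ∈ e.baseSet ∧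
    e.baseSet ⊆ (B : Set (RSpace n)) ∧
    ContMDiffOn (𝓡 m) ((𝓡 n).prod (𝓡 k)) ∞ e e.source ∧
    ContMDiffOn ((𝓡 n).prod (𝓡 k)) (𝓡 m) ∞ e.toOpenPartialHomeomorph.symm e.target

/-- The fibers of the submersion `f` are Lagrangian submanifolds: the tangent space at `x` of the
fiber through `x`, which is the kernel of the differential of `f`, is Lagrangian. -/
def HasLagrangianFibers {n : ℕ} (Ω : TwoForm m M) (f : M → RSpace n) : Prop :=
  ∀ x : M, IsLagrangianSubspace Ω x (LinearMap.ker (mfderiv (𝓡 m) (𝓡 n) f x).toLinearMap)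

/-- `φ` is a global coordinate system: a diffeomorphism of `M` onto an open subset of the vector
space `V`. -/
def IsGlobalCoordinateSystem {V : Type*} [NormedAddCommGroup V] [NormedSpace ℝ V]
    (φ : M → V) : Prop :=
  ∃ e : OpenPartialHomeomorph M V, e.source = Set.univ ∧ (∀ x, e x = φ x) ∧
    ContMDiff (𝓡 m) 𝓘(ℝ, V) ∞ e ∧ ContMDiffOn 𝓘(ℝ, V) (𝓡 m) ∞ e.symm e.target

/-- `(f₁, …, fₙ, g₁, …, gₙ)` is a global Darboux coordinate system for `Ω`: it is a global
coordinate system and `Ω = ∑ᵢ dfᵢ ∧ dgᵢ`. -/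
structure IsGlobalDarbouxCoordinateSystem {n : ℕ} (Ω : TwoForm m M) (f g : M → RSpace n) :
    Prop where
  coordinates : IsGlobalCoordinateSystem (m := m) (fun x ↦ (f x, g x))
  form_eq : ∀ (x : M) (v w : TangentSpace (𝓡 m) x),
    Ω x ![v, w] = ∑ i, (differential (fun y ↦ f y i) x v * differential (fun y ↦ g y i) x w
      - differential (fun y ↦ f y i) x w * differential (fun y ↦ g y i) x v)

end Symplectic

end

/-! Write `X u` for the combination `∑ uᵢ 𝕏_{fᵢ}`. Since `Ω (X u, ·) = ∑ uᵢ dfᵢ` vanishes on `ker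
df`, which is Lagrangian, `X u` is tangent to the fibers; a dimension count shows that the `X u`
fill the tangent spaces of the fibers.

Locally, closedness of `Ω` makes the contractions of `Ω` with horizontal coordinate vectors closed
along the fibers, and the Poincaré lemma with parameters yields `g` with `dg (X u) = u`. Hence `(f,
g)` is a chart in which `X u` is the constant field `(0, u)` (`exists_isFlatChart`). In these charts
flows are translations, so integral curves are unique, the flows commute, and completeness of the
`𝕏_{fᵢ}` passes to every `X u`. The time one maps thus form an action of `ℝⁿ` on each fiber, with
open orbits and discrete stabilizers. A connected fiber is a single orbit, and the orbit map is then
a covering of the fiber, hence injective because the fiber is simply connected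
(`existsUnique_timeOneMap_eq`).

So the fibers are torsors under `ℝⁿ`. Local sections give local translation coordinates on the
fibers, and averaging these with a partition of unity on `B` keeps equivariance, because the weights
are constant on fibers and sum to one (`exists_equivariant`). The resulting `(f, g)` identifies `M`
with `B × ℝⁿ`.

There `Ω - ∑ dgᵢ ∧ dfᵢ` is a closed form that comes from `B`, so it equals `dη` with `η = ∑ θᵢ dbᵢ`
because `H²(B) = 0` (`exists_base_primitive`). Then `Ω = ∑ d(gᵢ + θᵢ ∘ f) ∧ dfᵢ`, and `-(g + θ ∘ f)`
completes `f` to Darboux coordinates (`exists_isGlobalDarbouxCoordinateSystem`). -/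

noncomputable section

open Set Filter Topology Metric

/-! ### Integrals with parameters and the fiberwise Poincaré lemma -/

section Euclidean

universe u

/-- Differentiation under the integral sign, for a compact interval of integration. -/
theorem hasFDerivAt_intervalIntegral_of_contDiffOn {E G : Type u} [NormedAddCommGroup E]
    [NormedSpace ℝ E] [FiniteDimensional ℝ E] [NormedAddCommGroup G] [NormedSpace ℝ G]
    {W : Set (E × ℝ)} (hW : IsOpen W) {U : Set E} (hU : IsOpen U)
    (hUW : ∀ x ∈ U, ∀ t ∈ Icc (0 : ℝ) 1, (x, t) ∈ W) {F : E × ℝ → G} (hF : ContDiffOn ℝ 1 F W)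
    {x : E} (hx : x ∈ U) :
    HasFDerivAt (fun x ↦ ∫ t in (0 : ℝ)..1, F (x, t))
      (∫ t in (0 : ℝ)..1, (fderiv ℝ F (x, t)).comp (.inl ℝ E ℝ)) x := by
  have : ProperSpace E := FiniteDimensional.proper ℝ E
  have h01 : uIcc (0 : ℝ) 1 = Icc 0 1 := uIcc_of_le zero_le_one
  obtain ⟨r, hr, hrU⟩ := nhds_basis_closedBall.mem_iff.1 (hU.mem_nhds hx)
  have hF' : ContinuousOn (fun p ↦ (fderiv ℝ F p).comp (.inl ℝ E ℝ)) W :=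
    (hF.continuousOn_fderiv_of_isOpen hW le_rfl).clm_comp continuousOn_const
  have hcomp : IsCompact (closedBall x r ×ˢ Icc (0 : ℝ) 1) :=
    (isCompact_closedBall x r).prod isCompact_Icc
  have hsub : closedBall x r ×ˢ Icc (0 : ℝ) 1 ⊆ W := fun p hp ↦ hUW _ (hrU hp.1) _ hp.2
  obtain ⟨C, hC⟩ := hcomp.exists_bound_of_continuousOn (hF'.mono hsub)
  have hslice {G' : Type u} [NormedAddCommGroup G'] {H : E × ℝ → G'} (hH : ContinuousOn H W) {y : E}
      (hy : y ∈ U) : ContinuousOn (fun t ↦ H (y, t)) (Icc 0 1) :=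
    hH.comp (by fun_prop) fun t ht ↦ hUW y hy t ht
  have hint {G' : Type u} [NormedAddCommGroup G'] [NormedSpace ℝ G'] {H : E × ℝ → G'}
      (hH : ContinuousOn H W) {y : E} (hy : y ∈ U) :
      IntervalIntegrable (fun t ↦ H (y, t)) MeasureTheory.volume 0 1 :=
    ContinuousOn.intervalIntegrable (by rw [h01]; exact hslice hH hy)
  refine intervalIntegral.hasFDerivAt_integral_of_dominated_of_fderiv_le
    (F := fun x t ↦ F (x, t)) (F' := fun x t ↦ (fderiv ℝ F (x, t)).comp (.inl ℝ E ℝ))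
    (bound := fun _ ↦ C) (closedBall_mem_nhds x hr) ?_ (hint hF.continuousOn hx)
    ?_ ?_ intervalIntegrable_const ?_
  · filter_upwards [hU.mem_nhds hx] with y hy
    exact (hint hF.continuousOn hy).def'.aestronglyMeasurable
  · exact (hint hF' hx).def'.aestronglyMeasurable
  · refine .of_forall fun t ht y hy ↦ hC (y, t) ⟨hy, ?_⟩
    rw [uIoc_of_le zero_le_one] at ht
    exact Ioc_subset_Icc_self ht
  · refine .of_forall fun t ht y hy ↦ ?_
    rw [uIoc_of_le zero_le_one] at ht
    have hmem := hUW y (hrU hy) t (Ioc_subset_Icc_self ht)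
    have h1 : HasFDerivAt F (fderiv ℝ F (y, t)) (y, t) :=
      ((hF.contDiffAt (hW.mem_nhds hmem)).differentiableAt one_ne_zero).hasFDerivAt
    exact h1.comp y (hasFDerivAt_prodMk_left y t)

/-- Induction on `k`, differentiating under the integral; the base case already uses a derivative,
whence the order `k + 1` of `F`. The target space changes to `E →L[ℝ] G` in the induction, so `E`
and `G` share a universe. -/
theorem contDiffOn_intervalIntegral {E : Type u} [NormedAddCommGroup E]
    [NormedSpace ℝ E] [FiniteDimensional ℝ E]
    {W : Set (E × ℝ)} (hW : IsOpen W) {U : Set E} (hU : IsOpen U)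
    (hUW : ∀ x ∈ U, ∀ t ∈ Icc (0 : ℝ) 1, (x, t) ∈ W) (k : ℕ)
    {G : Type u} [NormedAddCommGroup G] [NormedSpace ℝ G] {F : E × ℝ → G}
    (hF : ContDiffOn ℝ (k + 1 : ℕ) F W) :
    ContDiffOn ℝ k (fun x ↦ ∫ t in (0 : ℝ)..1, F (x, t)) U := by
  induction k generalizing G with
  | zero =>
    refine contDiffOn_zero.2 fun x hx ↦ ?_
    exact (hasFDerivAt_intervalIntegral_of_contDiffOn hW hU hUW
      (hF.of_le (by simp)) hx).continuousAt.continuousWithinAt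
  | succ k ih =>
    have hF1 : ContDiffOn ℝ 1 F W := hF.of_le (by exact_mod_cast Nat.le_add_left 1 (k + 1))
    rw [Nat.cast_add, Nat.cast_one, contDiffOn_succ_iff_fderiv_of_isOpen hU]
    refine ⟨fun x hx ↦ (hasFDerivAt_intervalIntegral_of_contDiffOn hW hU hUW hF1
      hx).differentiableAt.differentiableWithinAt, by simp, ?_⟩
    refine ContDiffOn.congr (f := fun x ↦ ∫ t in (0 : ℝ)..1,
      (fderiv ℝ F (x, t)).comp (.inl ℝ E ℝ)) ?_ fun x hx ↦
        (hasFDerivAt_intervalIntegral_of_contDiffOn hW hU hUW hF1 hx).fderiv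
    exact ih ((hF.fderiv_of_isOpen hW (by norm_cast)).clm_comp contDiffOn_const)

/-- The Poincaré lemma for 1-forms on a ball, depending smoothly on parameters. -/
theorem exists_partial_primitive {P K G : Type} [NormedAddCommGroup P] [NormedSpace ℝ P]
    [FiniteDimensional ℝ P] [NormedAddCommGroup K] [NormedSpace ℝ K] [FiniteDimensional ℝ K]
    [NormedAddCommGroup G] [NormedSpace ℝ G] [CompleteSpace G] {z₀ : P × K} {r : ℝ}
    {A : P × K → K →L[ℝ] G} (hA : ContDiffOn ℝ ∞ A (ball z₀ r))
    (hsymm : ∀ z ∈ ball z₀ r, ∀ u v : K, fderiv ℝ A z (0, u) v = fderiv ℝ A z (0, v) u) :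
    ∃ g : P × K → G, ContDiffOn ℝ ∞ g (ball z₀ r) ∧
      ∀ z ∈ ball z₀ r, ∀ v, fderiv ℝ g z (0, v) = A z v := by
  rcases le_or_gt r 0 with hr | hr
  · exact ⟨0, by simp [ball_eq_empty.2 hr], by simp [ball_eq_empty.2 hr]⟩
  obtain ⟨b₀, y₀⟩ := z₀
  -- The product carries the sup norm, so each slice of the ball in the `K` direction is a ball and
  -- the segments from `y₀` stay inside.
  have hball : ball (b₀, y₀) r = ball b₀ r ×ˢ ball y₀ r := (ball_prod_same b₀ y₀ r).symm
  let L : (P × K) × ℝ → P × K := fun p ↦ (p.1.1, y₀ + p.2 • (p.1.2 - y₀))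
  have hL : ContDiff ℝ ∞ L := by fun_prop
  -- The primitive is the integral of `A` along the segment from `(b, y₀)` to `(b, y)`. In this form
  -- it is smooth in `b` and `y` jointly, while for fixed `b` it is the curve integral of the usual
  -- Poincaré lemma.
  let F : (P × K) × ℝ → G := fun p ↦ A (L p) (p.1.2 - y₀)
  let g : P × K → G := fun z ↦ ∫ t in (0 : ℝ)..1, F (z, t)
  have hW : IsOpen (L ⁻¹' ball (b₀, y₀) r) := isOpen_ball.preimage hL.continuous
  have hUW : ∀ x ∈ ball (b₀, y₀) r, ∀ t ∈ Icc (0 : ℝ) 1, (x, t) ∈ L ⁻¹' ball (b₀, y₀) r := by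
    intro x hx t ht
    rw [mem_preimage, hball]
    rw [hball] at hx
    exact ⟨hx.1, (convex_ball y₀ r).add_smul_sub_mem (mem_ball_self hr) hx.2 ht⟩
  have hF : ContDiffOn ℝ ∞ F (L ⁻¹' ball (b₀, y₀) r) :=
    (hA.comp hL.contDiffOn fun _ h ↦ h).clm_apply (by fun_prop)
  have hg : ContDiffOn ℝ ∞ g (ball (b₀, y₀) r) := by
    refine contDiffOn_infty.2 fun k ↦ contDiffOn_intervalIntegral hW isOpen_ball hUW k ?_
    exact hF.of_le (by exact_mod_cast le_top)
  refine ⟨g, hg, ?_⟩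
  rintro ⟨b, y⟩ hz v
  have hby := hz
  rw [hball] at hby
  have hAd : ∀ y' ∈ ball y₀ r, HasFDerivAt (fun y ↦ A (b, y))
      ((fderiv ℝ A (b, y')).comp (.inr ℝ P K)) y' := fun y' hy' ↦ by
    have hmem : (b, y') ∈ ball (b₀, y₀) r := by rw [hball]; exact ⟨hby.1, hy'⟩
    exact (((hA.contDiffAt (isOpen_ball.mem_nhds hmem)).differentiableAt
      (by simp)).hasFDerivAt).comp y' (hasFDerivAt_prodMk_right b y')
  have h1 := (convex_ball y₀ r).hasFDerivWithinAt_curveIntegral_segment_of_hasFDerivWithinAt_symmetric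
    (fun x hx ↦ (hAd x hx).hasFDerivWithinAt) (fun a ha u _ v _ ↦ by
      have hmem : (b, a) ∈ ball (b₀, y₀) r := by rw [hball]; exact ⟨hby.1, ha⟩
      simpa using hsymm _ hmem u v) (mem_ball_self hr) hby.2
  have h2 : HasFDerivAt (fun y ↦ g (b, y)) (A (b, y)) y := by
    refine (h1.hasFDerivAt (isOpen_ball.mem_nhds hby.2)).congr_of_eventuallyEq (.of_forall ?_)
    intro y'
    refine Eq.trans ?_ (curveIntegral_segment _ _ _).symm
    simp only [g, F, L, AffineMap.lineMap_apply, vsub_eq_sub, vadd_eq_add, add_comm]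
  have h3 := ((hg.contDiffAt (isOpen_ball.mem_nhds hz)).differentiableAt
    (by simp)).hasFDerivAt.comp y (hasFDerivAt_prodMk_right b y)
  have := congrArg (fun l ↦ l v) (h3.unique h2)
  simpa using this

end Euclidean

/-! ### Smoothness and exterior derivatives of forms on vector spaces -/

section Forms

variable {D E F : Type*} [NormedAddCommGroup D] [NormedSpace ℝ D] [NormedAddCommGroup E]
  [NormedSpace ℝ E] [NormedAddCommGroup F] [NormedSpace ℝ F]

/-- A form on a finite-dimensional space depends smoothly on a parameter if its values on constant
vectors do. -/
theorem contDiffOn_continuousAlternatingMap_apply [FiniteDimensional ℝ E] {k : WithTop ℕ∞}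
    {s : Set D} {n : ℕ} {α : D → E [⋀^Fin n]→L[ℝ] F}
    (h : ∀ v, ContDiffOn ℝ k (fun x ↦ α x v) s) : ContDiffOn ℝ k α s := by
  induction n with
  | zero =>
    let L : F →L[ℝ] E [⋀^Fin 0]→L[ℝ] F := LinearMap.mkContinuous
      { toFun := fun y ↦ ContinuousAlternatingMap.constOfIsEmpty ℝ E (Fin 0) y
        map_add' := fun _ _ ↦ by ext; simp
        map_smul' := fun _ _ ↦ by ext; simp } 1 fun y ↦ by simp
    refine (L.contDiff.comp_contDiffOn (h 0)).congr fun x _ ↦ ?_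
    ext v
    simp [L, Subsingleton.elim v 0]
  | succ n ih =>
    have h1 : ContDiffOn ℝ k (fun x ↦ (α x).curryLeft) s :=
      contDiffOn_clm_apply.2 fun v ↦ ih fun w ↦ h (Matrix.vecCons v w)
    -- Alternatizing the curried form returns `n + 1` times the form, so `α` is recovered from its
    -- currying by a continuous linear map.
    have h2 := (((n + 1 : ℝ)⁻¹ • ContinuousAlternatingMap.alternatizeUncurryFinCLM ℝ E F
      (n := n)).contDiff.comp_contDiffOn h1)
    refine h2.congr fun x _ ↦ ?_
    simp only [Function.comp_apply, smul_apply,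
      ContinuousAlternatingMap.alternatizeUncurryFinCLM_apply,
      ContinuousAlternatingMap.alternatizeUncurryFin_curryLeft]
    rw [← Nat.cast_smul_eq_nsmul ℝ, smul_smul]
    push_cast
    rw [inv_mul_cancel₀ (by positivity), one_smul]

theorem ContDiffOn.continuousAlternatingMap_apply_const {k : WithTop ℕ∞}
    {s : Set D} {n : ℕ} {α : D → E [⋀^Fin n]→L[ℝ] F} (h : ContDiffOn ℝ k α s) (v : Fin n → E) :
    ContDiffOn ℝ k (fun x ↦ α x v) s :=
  ((ContinuousAlternatingMap.apply ℝ E F v).contDiff).comp_contDiffOn h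

theorem ContDiffOn.continuousAlternatingMap_apply {k : WithTop ℕ∞}
    {s : Set D} {n : ℕ} {α : D → E [⋀^Fin n]→L[ℝ] F} {v : D → Fin n → E} (h : ContDiffOn ℝ k α s)
    (hv : ∀ i, ContDiffOn ℝ k (fun x ↦ v x i) s) :
    ContDiffOn ℝ k (fun x ↦ α x (v x)) s := by
  induction n with
  | zero =>
    refine (h.continuousAlternatingMap_apply_const 0).congr fun x _ ↦ ?_
    rw [Subsingleton.elim (v x) 0]
  | succ n ih =>
    have hL : ContDiff ℝ k fun a : E [⋀^Fin (n + 1)]→L[ℝ] F ↦ a.curryLeft :=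
      IsBoundedLinearMap.contDiff ⟨⟨fun _ _ ↦ rfl, fun _ _ ↦ rfl⟩, 1, one_pos, fun a ↦ by simp⟩
    have h0 : ContDiffOn ℝ k (fun x ↦ (α x).curryLeft) s := hL.comp_contDiffOn h
    have h1 : ContDiffOn ℝ k (fun x ↦ (α x).curryLeft (v x 0)) s := h0.clm_apply (hv 0)
    refine (ih (v := fun x i ↦ v x i.succ) h1 fun i ↦ hv i.succ).congr fun x _ ↦ ?_
    rw [ContinuousAlternatingMap.curryLeft_apply_apply]
    congr 1
    exact (Fin.cons_self_tail (v x)).symm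

theorem contDiffOn_pullback [FiniteDimensional ℝ D] {s : Set D} (hs : IsOpen s) {t : Set E}
    {n : ℕ} {α : E → E [⋀^Fin n]→L[ℝ] F} {θ : D → E} (hα : ContDiffOn ℝ ∞ α t)
    (hθ : ContDiffOn ℝ ∞ θ s) (hst : MapsTo θ s t) :
    ContDiffOn ℝ ∞ (fun x ↦ (α (θ x)).compContinuousLinearMap (fderiv ℝ θ x)) s := by
  refine contDiffOn_continuousAlternatingMap_apply fun v ↦ ?_
  exact (hα.comp hθ hst).continuousAlternatingMap_apply fun i ↦
    (hθ.fderiv_of_isOpen hs (by simp)).clm_apply contDiffOn_const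

/-- The exterior derivative of a 2-form on constant vectors. -/
theorem extDeriv_two_apply {α : E → E [⋀^Fin 2]→L[ℝ] F} {x : E} (h : DifferentiableAt ℝ α x)
    (a b c : E) : extDeriv α x ![a, b, c] = fderiv ℝ (fun y ↦ α y ![b, c]) x a
      - fderiv ℝ (fun y ↦ α y ![a, c]) x b + fderiv ℝ (fun y ↦ α y ![a, b]) x c := by
  rw [extDeriv_apply h, Fin.sum_univ_three]
  have h0 : (0 : Fin 3).removeNth ![a, b, c] = ![b, c] := by ext i; fin_cases i <;> rfl
  have h1 : (1 : Fin 3).removeNth ![a, b, c] = ![a, c] := by ext i; fin_cases i <;> rfl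
  have h2 : (2 : Fin 3).removeNth ![a, b, c] = ![a, b] := by ext i; fin_cases i <;> rfl
  simp [h0, h1, h2, sub_eq_add_neg]

/-- The exterior derivative of a 1-form on constant vectors. -/
theorem extDeriv_one_apply {α : E → E [⋀^Fin 1]→L[ℝ] F} {x : E} (h : DifferentiableAt ℝ α x)
    (a b : E) : extDeriv α x ![a, b] = fderiv ℝ (fun y ↦ α y ![b]) x a
      - fderiv ℝ (fun y ↦ α y ![a]) x b := by
  rw [extDeriv_apply h, Fin.sum_univ_two]
  have h0 : (0 : Fin 2).removeNth ![a, b] = ![b] := by ext i; fin_cases i; rfl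
  have h1 : (1 : Fin 2).removeNth ![a, b] = ![a] := by ext i; fin_cases i; rfl
  simp [h0, h1, sub_eq_add_neg]

theorem ContinuousAlternatingMap.apply_swap {V : Type*} [AddCommGroup V] [Module ℝ V]
    [TopologicalSpace V] (q : V [⋀^Fin 2]→L[ℝ] ℝ) (v w : V) : q ![v, w] = - q ![w, v] := by
  have h : ![w, v] ∘ Equiv.swap 0 1 = ![v, w] := by ext i; fin_cases i <;> rfl
  exact h ▸ q.toAlternatingMap.map_swap ![w, v] (i := 0) (j := 1) (by simp)

theorem ContinuousAlternatingMap.apply_two_add {V : Type*} [AddCommGroup V] [Module ℝ V]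
    [TopologicalSpace V] (q : V [⋀^Fin 2]→L[ℝ] ℝ) (v v' w : V) :
    q ![v + v', w] = q ![v, w] + q ![v', w] :=
  q.toContinuousMultilinearMap.cons_add ![w] v v'

theorem ContinuousAlternatingMap.apply_two_smul {V : Type*} [AddCommGroup V] [Module ℝ V]
    [TopologicalSpace V] (q : V [⋀^Fin 2]→L[ℝ] ℝ) (c : ℝ) (v w : V) :
    q ![c • v, w] = c * q ![v, w] :=
  q.toContinuousMultilinearMap.cons_smul ![w] c v

end Forms

/-! ### The inverse function theorem in vector spaces -/

section InverseFunction

variable {E F : Type*} [NormedAddCommGroup E] [NormedSpace ℝ E] [CompleteSpace E]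
  [NormedAddCommGroup F] [NormedSpace ℝ F] [CompleteSpace F]

/-- The inverse function theorem: a smooth map with a bijective derivative at a point is a smooth
partial homeomorphism around this point. -/
theorem exists_openPartialHomeomorph_of_bijective_fderiv {φ : E → F} {U : Set E} (hU : IsOpen U)
    (hφ : ContDiffOn ℝ ∞ φ U) {z₀ : E} (hz₀ : z₀ ∈ U)
    (hbij : Function.Bijective (fderiv ℝ φ z₀)) :
    ∃ e : OpenPartialHomeomorph E F, z₀ ∈ e.source ∧ e.source ⊆ U ∧ ⇑e = φ ∧
      ContDiffOn ℝ ∞ e.symm e.target := by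
  have hd {z : E} (hz : z ∈ U) : DifferentiableAt ℝ φ z :=
    (hφ.contDiffAt (hU.mem_nhds hz)).differentiableAt (by simp)
  -- Restricting to points with invertible derivative makes the inverse smooth on its whole domain,
  -- not only at the image of `z₀`.
  have hopen : IsOpen (U ∩ fderiv ℝ φ ⁻¹' range ((↑) : (E ≃L[ℝ] F) → E →L[ℝ] F)) :=
    (hφ.continuousOn_fderiv_of_isOpen hU (by simp)).isOpen_inter_preimage hU
      ContinuousLinearEquiv.isOpen
  let f' : E ≃L[ℝ] F := ContinuousLinearEquiv.ofBijective (fderiv ℝ φ z₀)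
    (LinearMap.ker_eq_bot.2 hbij.1) (LinearMap.range_eq_top.2 hbij.2)
  have hf' : (f' : E →L[ℝ] F) = fderiv ℝ φ z₀ := ContinuousLinearEquiv.coe_ofBijective _ _ _
  have hφ₀ := hφ.contDiffAt (hU.mem_nhds hz₀)
  have hder : HasFDerivAt φ (f' : E →L[ℝ] F) z₀ := hf' ▸ (hd hz₀).hasFDerivAt
  let e₀ := hφ₀.toOpenPartialHomeomorph φ hder (by simp)
  let e := e₀.restrOpen _ hopen
  have he : ⇑e = φ := rfl
  have hsource : e.source = e₀.source ∩
    (U ∩ fderiv ℝ φ ⁻¹' range ((↑) : (E ≃L[ℝ] F) → E →L[ℝ] F)) := e₀.restrOpen_source _ hopen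
  refine ⟨e, ?_, ?_, he, ?_⟩
  · rw [hsource]
    exact ⟨hφ₀.mem_toOpenPartialHomeomorph_source hder (by simp), hz₀, f', hf'⟩
  · rw [hsource]
    exact fun z hz ↦ hz.2.1
  · intro y hy
    have hy' := e.map_target hy
    rw [hsource] at hy'
    obtain ⟨-, hyU, g', hg'⟩ := hy'
    exact (e.contDiffAt_symm hy (f₀' := g') (by rw [hg', he]; exact (hd hyU).hasFDerivAt)
      (by rw [he]; exact hφ.contDiffAt (hU.mem_nhds hyU))).contDiffWithinAt

end InverseFunction

/-! ### Local functions conjugate to `f` -/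

section LocalPrimitive

variable {n : ℕ}

/-- A closed 2-form for which the fibres of a product are isotropic restricts, after contraction
with horizontal vectors, to fibrewise closed 1-forms, and has smooth fibrewise primitives. -/
theorem exists_fiber_primitive {K : Type} [NormedAddCommGroup K] [NormedSpace ℝ K]
    [FiniteDimensional ℝ K] {z₀ : RSpace n × K} {r : ℝ}
    {α : RSpace n × K → (RSpace n × K) [⋀^Fin 2]→L[ℝ] ℝ} (hα : ContDiffOn ℝ ∞ α (ball z₀ r))
    (hclosed : ∀ z ∈ ball z₀ r, extDeriv α z = 0)
    (hiso : ∀ z ∈ ball z₀ r, ∀ u v : K, α z ![(0, u), (0, v)] = 0) :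
    ∃ g : RSpace n × K → RSpace n, ContDiffOn ℝ ∞ g (ball z₀ r) ∧
      ∀ z ∈ ball z₀ r, ∀ v i, fderiv ℝ g z (0, v) i
        = α z ![(0, v), (EuclideanSpace.single i 1, 0)] := by
  let A : RSpace n × K → K →L[ℝ] RSpace n := fun z ↦ LinearMap.toContinuousLinearMap
    { toFun := fun v ↦ WithLp.toLp 2 fun i ↦ α z ![(0, v), (EuclideanSpace.single i 1, 0)]
      map_add' := fun v v' ↦ by
        ext i
        simp only [PiLp.add_apply]
        rw [← ContinuousAlternatingMap.apply_two_add]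
        simp
      map_smul' := fun c v ↦ by
        ext i
        simp only [PiLp.smul_apply, RingHom.id_apply, smul_eq_mul]
        rw [← ContinuousAlternatingMap.apply_two_smul]
        simp }
  have hAapp (z v i) : A z v i = α z ![(0, v), (EuclideanSpace.single i 1, 0)] := rfl
  have hA : ContDiffOn ℝ ∞ A (ball z₀ r) := by
    refine contDiffOn_clm_apply.2 fun v ↦ (contDiffOn_euclidean).2 fun i ↦ ?_
    exact hα.continuousAlternatingMap_apply_const _
  have hαd {z} (hz : z ∈ ball z₀ r) : DifferentiableAt ℝ α z :=
    (hα.contDiffAt (isOpen_ball.mem_nhds hz)).differentiableAt (by simp)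
  have hAd {z} (hz : z ∈ ball z₀ r) : DifferentiableAt ℝ A z :=
    (hA.contDiffAt (isOpen_ball.mem_nhds hz)).differentiableAt (by simp)
  have hfd {z} (hz : z ∈ ball z₀ r) (w v i) : fderiv ℝ A z w v i
      = fderiv ℝ (fun y ↦ α y ![(0, v), (EuclideanSpace.single i 1, 0)]) z w := by
    have h1 := ((EuclideanSpace.proj (𝕜 := ℝ) i : RSpace n →L[ℝ] ℝ).comp
      (ContinuousLinearMap.apply ℝ (RSpace n) v)).hasFDerivAt.comp z (hAd hz).hasFDerivAt
    have h2 : ((((EuclideanSpace.proj (𝕜 := ℝ) i : RSpace n →L[ℝ] ℝ).comp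
      (ContinuousLinearMap.apply ℝ (RSpace n) v)) ∘ A)) =
      (fun y ↦ α y ![(0, v), (EuclideanSpace.single i 1, 0)]) := rfl
    rw [h2] at h1
    rw [h1.fderiv]
    rfl
  obtain ⟨g, hg, hg'⟩ := exists_partial_primitive hA fun z hz u v ↦ by
    ext i
    rw [hfd hz, hfd hz]
    -- Of the three terms of `dα` on two vertical vectors and one horizontal vector, the one
    -- differentiating `α (u, v)` vanishes by isotropy; the other two give the symmetry that the
    -- Poincaré lemma requires.
    have h := extDeriv_two_apply (hαd hz) (0, u) (0, v) (EuclideanSpace.single i 1, 0)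
    have h0 : fderiv ℝ (fun y ↦ α y ![(0, u), (0, v)]) z = 0 := by
      have : (fun y ↦ α y ![(0, u), (0, v)]) =ᶠ[𝓝 z] fun _ ↦ 0 := by
        filter_upwards [isOpen_ball.mem_nhds hz] with y hy using hiso y hy u v
      rw [this.fderiv_eq]
      simp
    rw [hclosed z hz, h0] at h
    exact (sub_eq_zero.1 ((add_zero _).symm.trans h.symm))
  exact ⟨g, hg, fun z hz v i ↦ by rw [hg' z hz, hAapp]⟩

theorem minSmoothness_two_le_infty : minSmoothness ℝ 2 ≤ (∞ : WithTop ℕ∞) := by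
  rw [minSmoothness_of_isRCLikeNormedField]
  exact WithTop.coe_le_coe.2 (le_top : (2 : ℕ∞) ≤ ⊤)

/-- Let `α` be a closed 2-form and let `f` be a submersion for which the kernel of the derivative
consists of the values `X u` of vector fields with `α (X u, ·) = ∑ uᵢ dfᵢ`. Then there are locally
functions `gᵢ` with `dgᵢ (X u) = uᵢ`. -/
theorem exists_local_conjugate {E : Type} [NormedAddCommGroup E] [NormedSpace ℝ E]
    [FiniteDimensional ℝ E] {W : Set E} (hW : IsOpen W) {z₀ : E} (hz₀ : z₀ ∈ W)
    {α : E → E [⋀^Fin 2]→L[ℝ] ℝ} (hα : ContDiffOn ℝ ∞ α W) (hclosed : ∀ z ∈ W, extDeriv α z = 0)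
    {f : E → RSpace n} (hf : ContDiffOn ℝ ∞ f W) (X : E → RSpace n → E)
    (hX : ∀ z ∈ W, ∀ u w, α z ![X z u, w] = ∑ i, u i * fderiv ℝ f z w i)
    (hXf : ∀ z ∈ W, ∀ u, fderiv ℝ f z (X z u) = 0)
    (hker : ∀ z ∈ W, ∀ v, fderiv ℝ f z v = 0 → ∃ u, X z u = v)
    (hsurj : Function.Surjective (fderiv ℝ f z₀)) :
    ∃ U ⊆ W, IsOpen U ∧ z₀ ∈ U ∧ ∃ g : E → RSpace n, ContDiffOn ℝ ∞ g U ∧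
      ∀ z ∈ U, ∀ u, fderiv ℝ g z (X z u) = u := by
  have : CompleteSpace E := FiniteDimensional.complete ℝ E
  let K : Submodule ℝ E := LinearMap.ker (fderiv ℝ f z₀ : E →ₗ[ℝ] RSpace n)
  have : CompleteSpace K := FiniteDimensional.complete ℝ K
  -- A linear projection onto `ker df(z₀)` completes `f` to a local coordinate system `ψ = (f, P)`
  -- that straightens the fibers.
  obtain ⟨P₀, hP₀⟩ := K.subtype.exists_leftInverse_of_injective K.ker_subtype
  let P : E →L[ℝ] K := LinearMap.toContinuousLinearMap P₀
  have hP (k : K) : P k = k := LinearMap.congr_fun hP₀ k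
  let ψ : E → RSpace n × K := fun z ↦ (f z, P z)
  have hψ : ContDiffOn ℝ ∞ ψ W := hf.prodMk P.contDiff.contDiffOn
  have hfd {z} (hz : z ∈ W) : HasFDerivAt f (fderiv ℝ f z) z :=
    ((hf.contDiffAt (hW.mem_nhds hz)).differentiableAt (by simp)).hasFDerivAt
  have hψd {z} (hz : z ∈ W) : HasFDerivAt ψ ((fderiv ℝ f z).prod P) z :=
    (hfd hz).prodMk P.hasFDerivAt
  have hbij : Function.Bijective (fderiv ℝ ψ z₀) := by
    rw [(hψd hz₀).fderiv]
    constructor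
    · refine (injective_iff_map_eq_zero _).2 fun v hv ↦ ?_
      obtain ⟨h1, h2⟩ := Prod.ext_iff.1 hv
      have h3 := hP ⟨v, h1⟩
      exact congrArg Subtype.val (h3.symm.trans h2)
    · rintro ⟨b, k⟩
      obtain ⟨v, hv⟩ := hsurj b
      refine ⟨v + (k - P v : K), ?_⟩
      have hk : fderiv ℝ f z₀ (k - P v : K) = 0 := (k - P v : K).2
      refine Prod.ext ?_ ?_
      · change fderiv ℝ f z₀ (v + (k - P v : K)) = b
        rw [map_add, hk, hv, add_zero]
      · change P (v + (k - P v : K)) = k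
        rw [map_add, hP]
        abel
  obtain ⟨e, hz₀e, heW, heψ, hesymm⟩ := exists_openPartialHomeomorph_of_bijective_fderiv hW hψ hz₀ hbij
  have hθd {y} (hy : y ∈ e.target) : HasFDerivAt e.symm (fderiv ℝ e.symm y) y :=
    ((hesymm.contDiffAt (e.open_target.mem_nhds hy)).differentiableAt (by simp)).hasFDerivAt
  have hθW {y} (hy : y ∈ e.target) : e.symm y ∈ W := heW (e.map_target hy)
  have hψθ {y} (hy : y ∈ e.target) (w : RSpace n × K) :
      (fderiv ℝ f (e.symm y) (fderiv ℝ e.symm y w), P (fderiv ℝ e.symm y w)) = w := by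
    have h1 := (hψd (hθW hy)).comp y (hθd hy)
    have h2 : HasFDerivAt (ψ ∘ e.symm) (ContinuousLinearMap.id ℝ _) y := by
      refine (hasFDerivAt_id y).congr_of_eventuallyEq ?_
      filter_upwards [e.open_target.mem_nhds hy] with y' hy'
      exact heψ ▸ e.right_inv hy'
    exact congrArg (fun l ↦ l w) (h1.unique h2)
  have hθψ {z} (hz : z ∈ e.source) (v : E) :
      fderiv ℝ e.symm (ψ z) (fderiv ℝ f z v, P v) = v := by
    have hmem : ψ z ∈ e.target := heψ ▸ e.map_source hz
    have h1 := (hθd hmem).comp z (hψd (heW hz))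
    have h2 : HasFDerivAt (e.symm ∘ ψ) (ContinuousLinearMap.id ℝ _) z := by
      refine (hasFDerivAt_id z).congr_of_eventuallyEq ?_
      filter_upwards [e.open_source.mem_nhds hz] with y' hy'
      exact heψ ▸ e.left_inv hy'
    exact congrArg (fun l ↦ l v) (h1.unique h2)
  obtain ⟨r, hr, hrt⟩ := Metric.isOpen_iff.1 e.open_target (ψ z₀) (heψ ▸ e.map_source hz₀e)
  let β : RSpace n × K → (RSpace n × K) [⋀^Fin 2]→L[ℝ] ℝ := fun y ↦
    (α (e.symm y)).compContinuousLinearMap (fderiv ℝ e.symm y)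
  have hβapp (y) (v w) : β y ![v, w] = α (e.symm y) ![fderiv ℝ e.symm y v, fderiv ℝ e.symm y w] := by
    simp only [β, ContinuousAlternatingMap.compContinuousLinearMap_apply]
    congr 1
    ext i; fin_cases i <;> rfl
  have hβ : ContDiffOn ℝ ∞ β (ball (ψ z₀) r) :=
    contDiffOn_pullback isOpen_ball hα (hesymm.mono hrt) fun y hy ↦ hθW (hrt hy)
  obtain ⟨g, hg, hg'⟩ := exists_fiber_primitive hβ (fun y hy ↦ by
    have h := extDeriv_pullback (r := ∞) ((hα.contDiffAt (hW.mem_nhds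
      (hθW (hrt hy)))).differentiableAt (by simp)) (hesymm.contDiffAt
        (e.open_target.mem_nhds (hrt hy))) minSmoothness_two_le_infty
    rw [hclosed _ (hθW (hrt hy))] at h
    refine h.trans ?_
    ext v
    rfl) fun y hy u v ↦ by
      -- A vertical vector corresponds to some `X u'`, and `α (X u', ·)` is a combination of the
      -- `dfᵢ`, which vanish on vertical vectors.
      have hu := hψθ (hrt hy) (0, u)
      have hv := congrArg Prod.fst (hψθ (hrt hy) (0, v))
      obtain ⟨u', hu'⟩ := hker _ (hθW (hrt hy)) _ (Prod.ext_iff.1 hu).1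
      simp only at hv
      rw [hβapp, ← hu', hX _ (hθW (hrt hy)), hv]
      simp
  have hUopen : IsOpen (e.source ∩ ψ ⁻¹' ball (ψ z₀) r) := heψ ▸ e.isOpen_inter_preimage isOpen_ball
  refine ⟨e.source ∩ ψ ⁻¹' ball (ψ z₀) r, fun z hz ↦ heW hz.1, hUopen, ⟨hz₀e, mem_ball_self hr⟩,
    g ∘ ψ, hg.comp (hψ.mono fun z hz ↦ heW hz.1) fun z hz ↦ hz.2, fun z hz u ↦ ?_⟩
  have hzW := heW hz.1
  have h1 := ((hg.contDiffAt (isOpen_ball.mem_nhds hz.2)).differentiableAt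
    (by simp)).hasFDerivAt.comp z (hψd hzW)
  rw [h1.fderiv]
  ext i
  -- In the coordinates `ψ` this is the pairing of `X u` with the `i`-th horizontal coordinate
  -- vector `w`, namely `∑ uⱼ dfⱼ(w)`, and `df(w)` is the `i`-th basis vector.
  change fderiv ℝ g (ψ z) (fderiv ℝ f z (X z u), P (X z u)) i = u i
  have hleft : e.symm (ψ z) = z := heψ ▸ e.left_inv hz.1
  have h2 := hθψ hz.1 (X z u)
  have h3 := congrArg Prod.fst (hψθ (hrt hz.2) (EuclideanSpace.single i 1, 0))
  simp only at h3
  rw [hXf z hzW] at h2 ⊢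
  rw [hleft] at h3
  rw [hg' _ hz.2, hβapp, h2, hleft, hX z hzW, h3]
  simp

end LocalPrimitive

/-! ### The inverse function theorem on manifolds -/

section ManifoldInverse

variable {m : ℕ} {M : Type*} [TopologicalSpace M] [ChartedSpace (RSpace m) M]
  {W W' : Type*} [NormedAddCommGroup W] [NormedSpace ℝ W]
  [NormedAddCommGroup W'] [NormedSpace ℝ W']

variable (m) in
/-- The derivative of a map from a manifold to a vector space, with values in this vector space. -/
abbrev vectorDifferential (φ : M → W) (x : M) : TangentSpace (𝓡 m) x →L[ℝ] W :=
  mfderiv (𝓡 m) 𝓘(ℝ, W) φ x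

theorem HasMFDerivAt.prodMk_vector {x : M} {φ : M → W} {χ : M → W'}
    {φ' : TangentSpace (𝓡 m) x →L[ℝ] W} {χ' : TangentSpace (𝓡 m) x →L[ℝ] W'}
    (hφ : HasMFDerivAt (𝓡 m) 𝓘(ℝ, W) φ x φ') (hχ : HasMFDerivAt (𝓡 m) 𝓘(ℝ, W') χ x χ') :
    HasMFDerivAt (𝓡 m) 𝓘(ℝ, W × W') (fun y ↦ (φ y, χ y)) x (φ'.prod χ') :=
  ⟨hφ.1.prodMk hχ.1, hφ.2.prodMk hχ.2⟩

theorem mfderiv_prodMk_vector {x : M} {φ : M → W} {χ : M → W'}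
    (hφ : MDifferentiableAt (𝓡 m) 𝓘(ℝ, W) φ x) (hχ : MDifferentiableAt (𝓡 m) 𝓘(ℝ, W') χ x)
    (v : TangentSpace (𝓡 m) x) :
    vectorDifferential m (fun y ↦ (φ y, χ y)) x v =
      (vectorDifferential m φ x v, vectorDifferential m χ x v) := by
  have := (hφ.hasMFDerivAt.prodMk_vector hχ.hasMFDerivAt).mfderiv
  exact congrArg (fun l ↦ l v) this

theorem mfderiv_clm_comp {x : M} {φ : M → W} (hφ : MDifferentiableAt (𝓡 m) 𝓘(ℝ, W) φ x)
    (L : W →L[ℝ] W') (v : TangentSpace (𝓡 m) x) :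
    vectorDifferential m (fun y ↦ L (φ y)) x v = L (vectorDifferential m φ x v) := by
  have := (HasMFDerivAt.comp (I := 𝓡 m) (I' := 𝓘(ℝ, W)) (I'' := 𝓘(ℝ, W')) x
    L.hasMFDerivAt hφ.hasMFDerivAt).mfderiv
  exact congrArg (fun l ↦ l v) this

variable [IsManifold (𝓡 m) ∞ M]

theorem contMDiffOn_chartAt_symm (p : M) :
    ContMDiffOn 𝓘(ℝ, RSpace m) (𝓡 m) ∞ (chartAt (RSpace m) p).symm (chartAt (RSpace m) p).target :=
  contMDiffOn_chart_symm

theorem mdifferentiable_chartAt (p : M) :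
    (chartAt (RSpace m) p).MDifferentiable (𝓡 m) 𝓘(ℝ, RSpace m) :=
  haveI : IsManifold (𝓡 m) 1 M := .of_le (n := ∞) (by simp)
  mdifferentiable_chart p

/-- The inverse function theorem on a manifold, for maps into a vector space. -/
theorem exists_openPartialHomeomorph_of_bijective_mfderiv [CompleteSpace W] {φ : M → W} {U : Set M}
    (hU : IsOpen U) (hφ : ContMDiffOn (𝓡 m) 𝓘(ℝ, W) ∞ φ U) {p : M} (hp : p ∈ U)
    (hbij : Function.Bijective (vectorDifferential m φ p)) :
    ∃ e : OpenPartialHomeomorph M W, p ∈ e.source ∧ e.source ⊆ U ∧ (∀ x ∈ e.source, e x = φ x) ∧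
      ContMDiffOn 𝓘(ℝ, W) (𝓡 m) ∞ e.symm e.target := by
  let c := chartAt (RSpace m) p
  have hpc : p ∈ c.source := mem_chart_source _ p
  have hopen : IsOpen (c.target ∩ c.symm ⁻¹' U) := c.isOpen_inter_preimage_symm hU
  have hφc : ContDiffOn ℝ ∞ (φ ∘ c.symm) (c.target ∩ c.symm ⁻¹' U) :=
    (hφ.comp ((contMDiffOn_chartAt_symm p).mono fun z hz ↦ hz.1) fun z hz ↦ hz.2).contDiffOn
  have hφp : MDifferentiableAt (𝓡 m) 𝓘(ℝ, W) φ p :=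
    (hφ.contMDiffAt (hU.mem_nhds hp)).mdifferentiableAt (by simp)
  have hfd : fderiv ℝ (φ ∘ c.symm) (c p) = mfderiv (𝓡 m) 𝓘(ℝ, W) φ p := by
    rw [hφp.mfderiv, ← fderivWithin_univ]
    simp only [writtenInExtChartAt, extChartAt, mfld_simps]
    rfl
  obtain ⟨e, he, heU, heφ, hes⟩ := exists_openPartialHomeomorph_of_bijective_fderiv hopen hφc
    (z₀ := c p) ⟨c.map_source hpc, by rwa [mem_preimage, c.left_inv hpc]⟩ (by rw [hfd]; exact hbij)
  refine ⟨c.trans e, ?_, fun x hx ↦ ?_, fun x hx ↦ ?_, ?_⟩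
  · rw [OpenPartialHomeomorph.trans_source]
    exact ⟨hpc, he⟩
  · rw [OpenPartialHomeomorph.trans_source] at hx
    have := (heU hx.2).2
    rwa [mem_preimage, c.left_inv hx.1] at this
  · rw [OpenPartialHomeomorph.trans_source] at hx
    rw [OpenPartialHomeomorph.coe_trans, Function.comp_apply, heφ, Function.comp_apply,
      c.left_inv hx.1]
  · have h1 : ContMDiffOn 𝓘(ℝ, W) 𝓘(ℝ, RSpace m) ∞ e.symm (c.trans e).target :=
      hes.contMDiffOn.mono (by rw [OpenPartialHomeomorph.trans_target]; exact inter_subset_left)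
    refine (contMDiffOn_chartAt_symm p).comp h1 ?_
    rw [OpenPartialHomeomorph.trans_target]
    exact fun y hy ↦ hy.2

/-- An injective smooth map with bijective derivatives is a global coordinate system. -/
theorem isGlobalCoordinateSystem_of_bijective_mfderiv [CompleteSpace W] [Nonempty M] {φ : M → W}
    (hφ : ContMDiff (𝓡 m) 𝓘(ℝ, W) ∞ φ) (hinj : Function.Injective φ)
    (hbij : ∀ p, Function.Bijective (vectorDifferential m φ p)) :
    Symplectic.IsGlobalCoordinateSystem (m := m) φ := by
  have hloc (p : M) := exists_openPartialHomeomorph_of_bijective_mfderiv isOpen_univ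
    (hφ.contMDiffOn) (mem_univ p) (hbij p)
  have hopen : IsOpenMap φ := by
    refine IsOpenMap.of_nhds_le fun p ↦ ?_
    obtain ⟨e, hp, -, heφ, -⟩ := hloc p
    have h1 : φ =ᶠ[𝓝 p] e := by
      filter_upwards [e.open_source.mem_nhds hp] with x hx using (heφ x hx).symm
    rw [Filter.map_congr h1, e.map_nhds_eq hp, heφ p hp]
  -- By injectivity the global inverse agrees near each point of the image with a local smooth
  -- inverse.
  have hemb : IsOpenEmbedding φ := .of_continuous_injective_isOpenMap hφ.continuous hinj hopen
  refine ⟨hemb.toOpenPartialHomeomorph φ, rfl, fun _ ↦ rfl, hφ, ?_⟩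
  rw [hemb.toOpenPartialHomeomorph_target]
  rintro _ ⟨p, rfl⟩
  obtain ⟨e, hp, -, heφ, hes⟩ := hloc p
  have hmem : φ p ∈ e.target := heφ p hp ▸ e.map_source hp
  refine ((hes.contMDiffAt (e.open_target.mem_nhds hmem)).congr_of_eventuallyEq
    ?_).contMDiffWithinAt
  filter_upwards [e.open_target.mem_nhds hmem] with y hy
  apply hinj
  rw [hemb.toOpenPartialHomeomorph_right_inv, ← heφ _ (e.map_target hy), e.right_inv hy]
  exact ⟨e.symm y, by rw [← heφ _ (e.map_target hy), e.right_inv hy]⟩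

end ManifoldInverse

/-! ### Linear algebra of the Hamiltonian vector fields -/

section Hamiltonian

namespace Symplectic

variable {n : ℕ} {M : Type*} [TopologicalSpace M] [ChartedSpace (RSpace (2 * n)) M]

/-- The linear combination with coefficients `uᵢ` of the Hamiltonian vector fields of the
components of `f`. -/
def hamiltonianCombination (Ω : TwoForm (2 * n) M) (f : M → RSpace n) (u : RSpace n) (x : M) :
    TangentSpace (𝓡 (2 * n)) x :=
  ∑ i, u i • hamiltonianVectorField Ω (fun y ↦ f y i) x

variable {Ω : TwoForm (2 * n) M} {f : M → RSpace n}

theorem hamiltonianCombination_add (u u' : RSpace n) (x : M) :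
    hamiltonianCombination Ω f (u + u') x
      = hamiltonianCombination Ω f u x + hamiltonianCombination Ω f u' x := by
  simp [hamiltonianCombination, add_smul, Finset.sum_add_distrib]

theorem hamiltonianCombination_smul (c : ℝ) (u : RSpace n) (x : M) :
    hamiltonianCombination Ω f (c • u) x = c • hamiltonianCombination Ω f u x := by
  simp [hamiltonianCombination, mul_smul, Finset.smul_sum]

theorem hamiltonianCombination_zero (x : M) : hamiltonianCombination Ω f 0 x = 0 := by
  simp [hamiltonianCombination]

theorem hamiltonianCombination_single (i : Fin n) (x : M) :
    hamiltonianCombination Ω f (EuclideanSpace.single i 1) x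
      = hamiltonianVectorField Ω (fun y ↦ f y i) x := by
  rw [hamiltonianCombination, Finset.sum_eq_single i]
  · simp
  · intro j _ hj
    simp [hj]
  · simp

theorem differential_apply (hf : ContMDiff (𝓡 (2 * n)) (𝓡 n) ∞ f) (x : M)
    (w : TangentSpace (𝓡 (2 * n)) x) (i : Fin n) :
    differential (fun y ↦ f y i) x w = vectorDifferential (2 * n) f x w i :=
  mfderiv_clm_comp ((hf x).mdifferentiableAt (by simp)) (EuclideanSpace.proj i : RSpace n →L[ℝ] ℝ) w

theorem apply_hamiltonianCombination (hΩ : IsSymplecticForm Ω)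
    (hf : ContMDiff (𝓡 (2 * n)) (𝓡 n) ∞ f) (u : RSpace n) (x : M)
    (w : TangentSpace (𝓡 (2 * n)) x) : Ω x ![hamiltonianCombination Ω f u x, w]
      = ∑ i, u i * vectorDifferential (2 * n) f x w i := by
  let L : TangentSpace (𝓡 (2 * n)) x →ₗ[ℝ] ℝ :=
    { toFun := fun v ↦ Ω x ![v, w]
      map_add' := fun v v' ↦ (Ω x).apply_two_add v v' w
      map_smul' := fun c v ↦ (Ω x).apply_two_smul c v w }
  have : Ω x ![hamiltonianCombination Ω f u x, w] = L (hamiltonianCombination Ω f u x) := rfl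
  rw [this, hamiltonianCombination, map_sum]
  refine Finset.sum_congr rfl fun i _ ↦ ?_
  rw [map_smul, smul_eq_mul, ← differential_apply hf, ← hamiltonianVectorField_spec hΩ]
  rfl

/-- The field is `Ω`-orthogonal to `ker df`, which contains its own orthogonal complement. -/
theorem mfderiv_hamiltonianCombination (hΩ : IsSymplecticForm Ω)
    (hf : ContMDiff (𝓡 (2 * n)) (𝓡 n) ∞ f) (hlag : HasLagrangianFibers Ω f) (u : RSpace n) (x : M) :
    vectorDifferential (2 * n) f x (hamiltonianCombination Ω f u x) = 0 := by
  refine (hlag x (hamiltonianCombination Ω f u x)).2 fun w hw ↦ ?_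
  have hw' : vectorDifferential (2 * n) f x w = 0 := hw
  rw [apply_hamiltonianCombination hΩ hf, hw']
  exact Finset.sum_eq_zero fun i _ ↦ mul_zero _

theorem hamiltonianCombination_eq_zero {x : M}
    (hindep : LinearIndependent ℝ fun i ↦ hamiltonianVectorField Ω (fun y ↦ f y i) x)
    {u : RSpace n} (hu : hamiltonianCombination Ω f u x = 0) : u = 0 := by
  ext i
  exact Fintype.linearIndependent_iff.1 hindep u hu i

/-- If `u` is orthogonal to the range of `df`, then `Ω (X u, ·) = ∑ uᵢ dfᵢ = 0`, so `X u = 0` by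
non-degeneracy and `u = 0` by independence. -/
theorem surjective_mfderiv (hΩ : IsSymplecticForm Ω)
    (hf : ContMDiff (𝓡 (2 * n)) (𝓡 n) ∞ f) {x : M}
    (hindep : LinearIndependent ℝ fun i ↦ hamiltonianVectorField Ω (fun y ↦ f y i) x) :
    Function.Surjective (vectorDifferential (2 * n) f x) := by
  let L : RSpace (2 * n) →ₗ[ℝ] RSpace n := (vectorDifferential (2 * n) f x).toLinearMap
  suffices h : LinearMap.range L = ⊤ from LinearMap.range_eq_top.1 h
  rw [← Submodule.orthogonal_eq_bot_iff, Submodule.eq_bot_iff]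
  intro u hu
  refine hamiltonianCombination_eq_zero hindep (hΩ.nondegenerate x _ fun w ↦ ?_)
  rw [apply_hamiltonianCombination hΩ hf]
  have := hu (L w) ⟨w, rfl⟩
  rw [PiLp.inner_apply] at this
  have h : ∑ i, u i * L w i = 0 := by simpa using this
  exact h

/-- Dimension count: `u ↦ X u` is injective into `ker df`, and `ker df` has dimension `2n - n = n`
since `df` is surjective. -/
theorem exists_hamiltonianCombination_eq (hΩ : IsSymplecticForm Ω)
    (hf : ContMDiff (𝓡 (2 * n)) (𝓡 n) ∞ f) (hlag : HasLagrangianFibers Ω f) {x : M}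
    (hindep : LinearIndependent ℝ fun i ↦ hamiltonianVectorField Ω (fun y ↦ f y i) x)
    {v : TangentSpace (𝓡 (2 * n)) x} (hv : vectorDifferential (2 * n) f x v = 0) :
    ∃ u, hamiltonianCombination Ω f u x = v := by
  let L : RSpace (2 * n) →ₗ[ℝ] RSpace n := (vectorDifferential (2 * n) f x).toLinearMap
  let X : RSpace n →ₗ[ℝ] RSpace (2 * n) :=
    { toFun := fun u ↦ hamiltonianCombination Ω f u x
      map_add' := fun u u' ↦ hamiltonianCombination_add u u' x
      map_smul' := fun c u ↦ hamiltonianCombination_smul c u x }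
  have hX : Function.Injective X :=
    (injective_iff_map_eq_zero X).2 fun u hu ↦ hamiltonianCombination_eq_zero hindep hu
  have hle : LinearMap.range X ≤ LinearMap.ker L := by
    rintro _ ⟨u, rfl⟩
    exact mfderiv_hamiltonianCombination hΩ hf hlag u x
  have hL : LinearMap.range L = ⊤ := LinearMap.range_eq_top.2 (surjective_mfderiv hΩ hf hindep)
  have h1 := L.finrank_range_add_finrank_ker
  have h2 := LinearMap.finrank_range_of_inj hX
  rw [hL, finrank_top, finrank_euclideanSpace_fin, finrank_euclideanSpace_fin] at h1
  rw [finrank_euclideanSpace_fin] at h2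
  have heq := Submodule.eq_of_le_of_finrank_eq hle (by omega)
  have : v ∈ LinearMap.range X := heq ▸ (hv : v ∈ LinearMap.ker L)
  exact this

end Symplectic

end Hamiltonian

theorem ContinuousAlternatingMap.compContinuousLinearMap_two {V V' : Type*} [AddCommGroup V]
    [Module ℝ V] [TopologicalSpace V] [AddCommGroup V'] [Module ℝ V'] [TopologicalSpace V']
    (q : V [⋀^Fin 2]→L[ℝ] ℝ) (L : V' →L[ℝ] V) (v w : V') :
    q.compContinuousLinearMap L ![v, w] = q ![L v, L w] := by
  rw [ContinuousAlternatingMap.compContinuousLinearMap_apply]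
  congr 1
  ext i; fin_cases i <;> rfl

/-! ### Flat charts -/

namespace Symplectic

section FlatChart

/-- A chart with values in `ℝⁿ × ℝⁿ` whose first component is `f` and in which the vector fields
`X u` are the constant vector fields `(0, u)`. -/
structure IsFlatChart {m n : ℕ} {M : Type*} [TopologicalSpace M] [ChartedSpace (RSpace m) M]
    (f : M → RSpace n) (X : RSpace n → ∀ x : M, TangentSpace (𝓡 m) x)
    (e : OpenPartialHomeomorph M (RSpace n × RSpace n)) : Prop where
  contMDiffOn : ContMDiffOn (𝓡 m) 𝓘(ℝ, RSpace n × RSpace n) ∞ e e.source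
  contMDiffOn_symm : ContMDiffOn 𝓘(ℝ, RSpace n × RSpace n) (𝓡 m) ∞ e.symm e.target
  fst_eq : ∀ x ∈ e.source, (e x).1 = f x
  vectorDifferential_eq : ∀ x ∈ e.source, ∀ u, vectorDifferential m e x (X u x) = (0, u)

variable {n : ℕ} {M : Type*} [TopologicalSpace M] [ChartedSpace (RSpace (2 * n)) M]
  {Ω : TwoForm (2 * n) M} {f : M → RSpace n}

/-- The derivative of `(f, g)` is bijective if `g` is a conjugate of `f` up to a sign. -/
theorem bijective_vectorDifferential_prodMk (hΩ : IsSymplecticForm Ω)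
    (hf : ContMDiff (𝓡 (2 * n)) (𝓡 n) ∞ f) (hlag : HasLagrangianFibers Ω f) {x : M}
    (hindep : LinearIndependent ℝ fun i ↦ hamiltonianVectorField Ω (fun y ↦ f y i) x)
    {g : M → RSpace n} (hg : MDifferentiableAt (𝓡 (2 * n)) 𝓘(ℝ, RSpace n) g x) {c : ℝ} (hc : c ≠ 0)
    (hgX : ∀ u, vectorDifferential (2 * n) g x (hamiltonianCombination Ω f u x) = c • u) :
    Function.Bijective (vectorDifferential (2 * n) (fun y ↦ (f y, g y)) x) := by
  have hfx : MDifferentiableAt (𝓡 (2 * n)) 𝓘(ℝ, RSpace n) f x := (hf x).mdifferentiableAt (by simp)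
  let L : RSpace (2 * n) →ₗ[ℝ] RSpace n × RSpace n :=
    (vectorDifferential (2 * n) (fun y ↦ (f y, g y)) x).toLinearMap
  have hL : Function.Injective L := by
    refine (injective_iff_map_eq_zero L).2 fun v hv ↦ ?_
    have h := (mfderiv_prodMk_vector hfx hg v).symm.trans hv
    obtain ⟨h1, h2⟩ := Prod.ext_iff.1 h
    obtain ⟨u, rfl⟩ := exists_hamiltonianCombination_eq hΩ hf hlag hindep h1
    have h3 : c • u = 0 := (hgX u).symm.trans h2
    rw [(smul_eq_zero.1 h3).resolve_left hc]
    exact hamiltonianCombination_zero x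
  have hdim : Module.finrank ℝ (RSpace (2 * n)) = Module.finrank ℝ (RSpace n × RSpace n) := by
    rw [Module.finrank_prod, finrank_euclideanSpace_fin, finrank_euclideanSpace_fin]
    omega
  have hL' : Function.Surjective L :=
    (LinearMap.injective_iff_surjective_of_finrank_eq_finrank hdim).1 hL
  exact ⟨hL, hL'⟩

/-- `exists_local_conjugate`, applied in a chart of `M`, gives `g` with `dg (X u) = u`. With `df (X
u) = 0` this says that `(f, g)` sends `X u` to `(0, u)`, and the inverse function theorem makes it a
chart. -/
theorem exists_isFlatChart [IsManifold (𝓡 (2 * n)) ∞ M] (hΩ : IsSymplecticForm Ω)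
    (hf : ContMDiff (𝓡 (2 * n)) (𝓡 n) ∞ f) (hlag : HasLagrangianFibers Ω f)
    (hindep : ∀ x, LinearIndependent ℝ fun i ↦ hamiltonianVectorField Ω (fun y ↦ f y i) x)
    (p : M) : ∃ e, p ∈ e.source ∧ IsFlatChart f (hamiltonianCombination Ω f) e := by
  let c := chartAt (RSpace (2 * n)) p
  have hpc : p ∈ c.source := mem_chart_source _ p
  have hcd := mdifferentiable_chartAt (m := 2 * n) p
  have hfd (x : M) : MDifferentiableAt (𝓡 (2 * n)) 𝓘(ℝ, RSpace n) f x :=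
    (hf x).mdifferentiableAt (by simp)
  have htarget : (extChartAt (𝓡 (2 * n)) p).target = c.target := by
    simp only [extChartAt, mfld_simps]
    rfl
  let D (z : RSpace (2 * n)) : RSpace (2 * n) →L[ℝ] TangentSpace (𝓡 (2 * n)) (c.symm z) :=
    mfderiv 𝓘(ℝ, RSpace (2 * n)) (𝓡 (2 * n)) c.symm z
  let fc : RSpace (2 * n) → RSpace n := f ∘ c.symm
  have hfc : ContDiffOn ℝ ∞ fc c.target := (hf.comp_contMDiffOn (contMDiffOn_chartAt_symm p)).contDiffOn
  have hfcd {z} (hz : z ∈ c.target) (w : RSpace (2 * n)) :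
      fderiv ℝ fc z w = vectorDifferential (2 * n) f (c.symm z) (D z w) := by
    have h := HasMFDerivAt.comp (I := 𝓘(ℝ, RSpace (2 * n))) (I' := 𝓡 (2 * n)) (I'' := 𝓘(ℝ, RSpace n))
      z (hfd (c.symm z)).hasMFDerivAt (hcd.mdifferentiableAt_symm hz).hasMFDerivAt
    let F : RSpace (2 * n) →L[ℝ] RSpace n := (vectorDifferential (2 * n) f (c.symm z)).comp (D z)
    have h2 : HasFDerivAt fc F z := hasMFDerivAt_iff_hasFDerivAt.1 h
    exact congrArg (fun l ↦ l w) h2.fderiv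
  let X (z : RSpace (2 * n)) (u : RSpace n) : RSpace (2 * n) :=
    mfderiv (𝓡 (2 * n)) 𝓘(ℝ, RSpace (2 * n)) c (c.symm z) (hamiltonianCombination Ω f u (c.symm z))
  have hDX {z} (hz : z ∈ c.target) (u) : D z (X z u) = hamiltonianCombination Ω f u (c.symm z) := by
    have h := hcd.symm_comp_deriv (c.map_target hz)
    rw [c.right_inv hz] at h
    exact congrArg (fun l ↦ l (hamiltonianCombination Ω f u (c.symm z))) h
  have hXD {z} (hz : z ∈ c.target) (v : RSpace (2 * n)) :
      (mfderiv (𝓡 (2 * n)) 𝓘(ℝ, RSpace (2 * n)) c (c.symm z) (D z v) : RSpace (2 * n)) = v :=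
    congrArg (fun l ↦ l v) (hcd.comp_symm_deriv hz)
  obtain ⟨U, hUc, hU, hpU, g, hg, hgX⟩ := exists_local_conjugate (α := chartForm Ω p) (f := fc)
    c.open_target (c.map_source hpc) (htarget ▸ hΩ.smooth p) (htarget ▸ hΩ.closed p) hfc X
    (fun z hz u w ↦ by
      have h1 : chartForm Ω p z ![X z u, w] = Ω (c.symm z) ![D z (X z u), D z w] :=
        ContinuousAlternatingMap.compContinuousLinearMap_two _ _ _ _
      rw [h1, hDX hz, apply_hamiltonianCombination hΩ hf]
      simp only [hfcd hz])
    (fun z hz u ↦ by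
      rw [hfcd hz, hDX hz]
      exact mfderiv_hamiltonianCombination hΩ hf hlag u _)
    (fun z hz v hv ↦ by
      rw [hfcd hz] at hv
      obtain ⟨u, hu⟩ := exists_hamiltonianCombination_eq hΩ hf hlag (hindep _) hv
      exact ⟨u, by simp only [X, hu]; exact hXD hz v⟩)
    (fun b ↦ by
      obtain ⟨w, hw⟩ := surjective_mfderiv hΩ hf (hindep (c.symm (c p))) b
      have hcp := c.map_source hpc
      have h := hcd.symm_comp_deriv (c.map_target hcp)
      rw [c.right_inv hcp] at h
      let w' : RSpace (2 * n) := mfderiv (𝓡 (2 * n)) 𝓘(ℝ, RSpace (2 * n)) c (c.symm (c p)) w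
      have hw' : D (c p) w' = w := congrArg (fun l ↦ l w) h
      exact ⟨w', by rw [hfcd hcp w', hw', hw]⟩)
  have hopen : IsOpen (c.source ∩ c ⁻¹' U) := c.isOpen_inter_preimage hU
  have hgc : ContMDiffOn (𝓡 (2 * n)) 𝓘(ℝ, RSpace n) ∞ (g ∘ c) (c.source ∩ c ⁻¹' U) :=
    hg.contMDiffOn.comp ((contMDiffOn_chart (I := 𝓡 (2 * n)) (n := ∞) (x := p)).mono
      fun x hx ↦ hx.1) fun x hx ↦ hx.2
  have hgcd {x} (hx : x ∈ c.source ∩ c ⁻¹' U) :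
      MDifferentiableAt (𝓡 (2 * n)) 𝓘(ℝ, RSpace n) (g ∘ c) x :=
    (hgc.contMDiffAt (hopen.mem_nhds hx)).mdifferentiableAt (by simp)
  have hgcX {x} (hx : x ∈ c.source ∩ c ⁻¹' U) (u) :
      vectorDifferential (2 * n) (g ∘ c) x (hamiltonianCombination Ω f u x) = u := by
    have hgd : HasFDerivAt g (fderiv ℝ g (c x)) (c x) :=
      ((hg.contDiffAt (hU.mem_nhds hx.2)).differentiableAt (by simp)).hasFDerivAt
    have h := HasMFDerivAt.comp (I := 𝓡 (2 * n)) (I' := 𝓘(ℝ, RSpace (2 * n)))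
      (I'' := 𝓘(ℝ, RSpace n)) x hgd.hasMFDerivAt (hcd.mdifferentiableAt hx.1).hasMFDerivAt
    have h2 := hgX (c x) hx.2 u
    simp only [X] at h2
    rw [c.left_inv hx.1] at h2
    exact (congrArg (fun l ↦ l (hamiltonianCombination Ω f u x)) h.mfderiv).trans h2
  have hφ : ContMDiffOn (𝓡 (2 * n)) 𝓘(ℝ, RSpace n × RSpace n) ∞ (fun x ↦ (f x, (g ∘ c) x))
      (c.source ∩ c ⁻¹' U) := hf.contMDiffOn.prodMk_space hgc
  obtain ⟨e, hpe, heU, heφ, hes⟩ := exists_openPartialHomeomorph_of_bijective_mfderiv hopen hφ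
    ⟨hpc, hpU⟩ (bijective_vectorDifferential_prodMk hΩ hf hlag (hindep p) (hgcd ⟨hpc, hpU⟩)
      one_ne_zero fun u ↦ by rw [hgcX ⟨hpc, hpU⟩, one_smul])
  refine ⟨e, hpe, (hφ.mono heU).congr heφ, hes, fun x hx ↦ by rw [heφ x hx], fun x hx u ↦ ?_⟩
  have heq : e =ᶠ[𝓝 x] fun x ↦ (f x, (g ∘ c) x) := by
    filter_upwards [e.open_source.mem_nhds hx] with y hy using heφ y hy
  have h1 : vectorDifferential (2 * n) e x = vectorDifferential (2 * n)
    (fun x ↦ (f x, (g ∘ c) x)) x := heq.mfderiv_eq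
  rw [h1, mfderiv_prodMk_vector (hfd x) (hgcd (heU hx)), hgcX (heU hx)]
  exact congrArg (fun w ↦ (w, u)) (mfderiv_hamiltonianCombination hΩ hf hlag u x)

end FlatChart

end Symplectic

/-! ### Velocities of curves -/

namespace Symplectic

section Curves

variable {m : ℕ} {M : Type*} [TopologicalSpace M] [ChartedSpace (RSpace m) M]
  {W : Type*} [NormedAddCommGroup W] [NormedSpace ℝ W]

/-- The curve `γ` has velocity `v` at time `t`. -/
abbrev HasVelocityAt (γ : ℝ → M) (t : ℝ) (v : TangentSpace (𝓡 m) (γ t)) : Prop :=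
  HasMFDerivAt 𝓘(ℝ, ℝ) (𝓡 m) γ t ((1 : ℝ →L[ℝ] ℝ).smulRight v)

theorem HasVelocityAt.hasDerivAt_comp {γ : ℝ → M} {t : ℝ} {v : TangentSpace (𝓡 m) (γ t)}
    (hγ : HasVelocityAt γ t v) {φ : M → W} (hφ : MDifferentiableAt (𝓡 m) 𝓘(ℝ, W) φ (γ t)) :
    HasDerivAt (φ ∘ γ) (vectorDifferential m φ (γ t) v) t := by
  have h := HasMFDerivAt.comp (I := 𝓘(ℝ, ℝ)) (I' := 𝓡 m) (I'' := 𝓘(ℝ, W)) t hφ.hasMFDerivAt hγ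
  let F : ℝ →L[ℝ] W := (vectorDifferential m φ (γ t)).comp ((1 : ℝ →L[ℝ] ℝ).smulRight v)
  have h2 : HasFDerivAt (φ ∘ γ) F t := hasMFDerivAt_iff_hasFDerivAt.1 h
  have h3 : F 1 = vectorDifferential m φ (γ t) v := by
    change vectorDifferential m φ (γ t) ((1 : ℝ) • v) = _
    rw [one_smul]
  exact h3 ▸ h2.hasDerivAt

theorem HasVelocityAt.comp {γ : ℝ → M} {t : ℝ} {v : TangentSpace (𝓡 m) (γ t)}
    (hγ : HasVelocityAt γ t v) {θ : M → M} (hθ : MDifferentiableAt (𝓡 m) (𝓡 m) θ (γ t)) :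
    HasVelocityAt (θ ∘ γ) t (mfderiv (𝓡 m) (𝓡 m) θ (γ t) v) := by
  have h := HasMFDerivAt.comp (I := 𝓘(ℝ, ℝ)) (I' := 𝓡 m) (I'' := 𝓡 m) t hθ.hasMFDerivAt hγ
  refine h.congr_mfderiv (ContinuousLinearMap.ext fun r ↦ ?_)
  exact (mfderiv (𝓡 m) (𝓡 m) θ (γ t)).map_smul r v

theorem hasVelocityAt_comp {c : ℝ → W} {t : ℝ} {w : W} (hc : HasDerivAt c w t) {σ : W → M}
    (hσ : MDifferentiableAt 𝓘(ℝ, W) (𝓡 m) σ (c t)) :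
    HasVelocityAt (σ ∘ c) t (mfderiv 𝓘(ℝ, W) (𝓡 m) σ (c t) w) := by
  have h := HasMFDerivAt.comp (I := 𝓘(ℝ, ℝ)) (I' := 𝓘(ℝ, W)) (I'' := 𝓡 m) t hσ.hasMFDerivAt
    hc.hasFDerivAt.hasMFDerivAt
  refine h.congr_mfderiv (ContinuousLinearMap.ext fun r ↦ ?_)
  exact (mfderiv 𝓘(ℝ, W) (𝓡 m) σ (c t)).map_smul r w

theorem HasVelocityAt.congr_velocity {γ : ℝ → M} {t : ℝ} {v w : TangentSpace (𝓡 m) (γ t)}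
    (hγ : HasVelocityAt γ t v) (h : v = w) : HasVelocityAt γ t w := h ▸ hγ

end Curves

/-! ### Integral curves in flat charts -/

section Flat

variable {m n : ℕ} {M : Type*} [TopologicalSpace M] [ChartedSpace (RSpace m) M]

/-- The vector fields `X u` are homogeneous in `u` and are, together with `f`, standard in suitable
charts around each point. -/
structure IsFlatFibration (f : M → RSpace n) (X : RSpace n → ∀ x : M, TangentSpace (𝓡 m) x) :
    Prop where
  map_smul : ∀ (c : ℝ) u x, X (c • u) x = c • X u x
  exists_chart : ∀ p, ∃ e, p ∈ e.source ∧ IsFlatChart f X e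

variable {f : M → RSpace n} {X : RSpace n → ∀ x : M, TangentSpace (𝓡 m) x}
  {e : OpenPartialHomeomorph M (RSpace n × RSpace n)}

theorem IsFlatChart.mdifferentiable (he : IsFlatChart f X e) :
    e.MDifferentiable (𝓡 m) 𝓘(ℝ, RSpace n × RSpace n) :=
  ⟨he.contMDiffOn.mdifferentiableOn (by simp), he.contMDiffOn_symm.mdifferentiableOn (by simp)⟩

theorem IsFlatChart.mfderiv_symm (he : IsFlatChart f X e) {y : RSpace n × RSpace n}
    (hy : y ∈ e.target) (u : RSpace n) :
    mfderiv 𝓘(ℝ, RSpace n × RSpace n) (𝓡 m) e.symm y ((0, u) : RSpace n × RSpace n)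
      = X u (e.symm y) := by
  have h := he.mdifferentiable.symm_comp_deriv (e.map_target hy)
  rw [e.right_inv hy] at h
  have h2 := congrArg (fun l ↦ l (X u (e.symm y))) h
  have h3 := he.vectorDifferential_eq _ (e.map_target hy) u
  have h4 : mfderiv 𝓘(ℝ, RSpace n × RSpace n) (𝓡 m) e.symm y
    (vectorDifferential m e (e.symm y) (X u (e.symm y))) = X u (e.symm y) := h2
  rwa [h3] at h4

/-- The translation by `(0, u)` in a flat chart. -/
def chartShift (e : OpenPartialHomeomorph M (RSpace n × RSpace n)) (u : RSpace n) (x : M) : M :=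
  e.symm (e x + (0, u))

theorem IsFlatChart.hasVelocityAt_symm (he : IsFlatChart f X e) {y : RSpace n × RSpace n}
    {u : RSpace n} {t : ℝ} (hy : y + t • (0, u) ∈ e.target) :
    HasVelocityAt (fun s ↦ e.symm (y + s • (0, u))) t (X u (e.symm (y + t • (0, u)))) := by
  have hc : HasDerivAt (fun s : ℝ ↦ y + s • ((0, u) : RSpace n × RSpace n)) (0, u) t := by
    simpa using ((hasDerivAt_id t).smul_const ((0, u) : RSpace n × RSpace n)).const_add y
  exact (hasVelocityAt_comp hc (he.mdifferentiable.mdifferentiableAt_symm hy)).congr_velocity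
    (he.mfderiv_symm hy u)

/-- In a flat chart, integral curves of `X u` are lines with direction `(0, u)`. -/
theorem IsFlatChart.eventually_eq (he : IsFlatChart f X e) {γ : ℝ → M} {t₀ : ℝ} {u : RSpace n}
    (hγ : IsMIntegralCurveAt (I := 𝓡 m) γ (X u) t₀) (h₀ : γ t₀ ∈ e.source) :
    ∀ᶠ t in 𝓝 t₀, γ t = e.symm (e (γ t₀) + (t - t₀) • (0, u)) := by
  have hsource : ∀ᶠ t in 𝓝 t₀, γ t ∈ e.source :=
    hγ.continuousAt.eventually_mem (e.open_source.mem_nhds h₀)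
  obtain ⟨δ, hδ, hball⟩ := Metric.eventually_nhds_iff_ball.1 (hsource.and hγ)
  filter_upwards [Metric.ball_mem_nhds t₀ hδ] with t ht
  -- The chart turns the velocity into the constant `(0, u)`; after subtracting that motion, a curve
  -- with zero derivative remains.
  let F : ℝ → RSpace n × RSpace n := fun t ↦ e (γ t) - (t - t₀) • ((0, u) : RSpace n × RSpace n)
  have hF (s) (hs : s ∈ ball t₀ δ) : HasDerivAt F 0 s := by
    have h1 := HasVelocityAt.hasDerivAt_comp (hball s hs).2
      (he.mdifferentiable.mdifferentiableAt (hball s hs).1)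
    rw [he.vectorDifferential_eq _ (hball s hs).1] at h1
    have h2 := h1.sub (((hasDerivAt_id s).sub_const t₀).smul_const ((0, u) : RSpace n × RSpace n))
    rw [one_smul, sub_self] at h2
    exact h2
  have hconst : F t = F t₀ := isOpen_ball.is_const_of_deriv_eq_zero
    (convex_ball t₀ δ).isPreconnected
    (fun s hs ↦ (hF s hs).differentiableAt.differentiableWithinAt) (fun s hs ↦ (hF s hs).deriv) ht
    (mem_ball_self hδ)
  have h2 : e (γ t) = e (γ t₀) + (t - t₀) • ((0, u) : RSpace n × RSpace n) := by
    have h3 : e (γ t) - (t - t₀) • ((0, u) : RSpace n × RSpace n) = e (γ t₀) := by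
      refine hconst.trans ?_
      simp only [F]
      rw [sub_self, zero_smul, sub_zero]
    rw [← h3, sub_add_cancel]
  rw [← h2, e.left_inv (hball t ht).1]

variable [T2Space M]

/-- Uniqueness of integral curves of the vector fields `X u`. -/
theorem IsFlatFibration.eqOn_Ioo (h : IsFlatFibration f X) {γ γ' : ℝ → M} {a b t₀ : ℝ} {u : RSpace n}
    (ht₀ : t₀ ∈ Ioo a b) (hγ : ∀ t ∈ Ioo a b, HasVelocityAt γ t (X u (γ t)))
    (hγ' : ∀ t ∈ Ioo a b, HasVelocityAt γ' t (X u (γ' t))) (h₀ : γ t₀ = γ' t₀) :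
    EqOn γ γ' (Ioo a b) := by
  suffices hsub : Ioo a b ⊆ {t | γ t = γ' t} ∩ Ioo a b from fun t ht ↦ (hsub ht).1
  -- The coincidence set is open by the local form of integral curves and closed in the interval
  -- because `M` is Hausdorff.
  refine isPreconnected_Ioo.subset_of_closure_inter_subset ?_ ⟨t₀, ht₀, h₀, ht₀⟩ ?_
  · refine isOpen_iff_mem_nhds.2 fun t ht ↦ ?_
    obtain ⟨e, hpe, he⟩ := h.exists_chart (γ t)
    have hnhds := Ioo_mem_nhds ht.2.1 ht.2.2
    have h1 := he.eventually_eq (γ := γ) (u := u) (by filter_upwards [hnhds] with s hs using hγ s hs) hpe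
    have h2 := he.eventually_eq (γ := γ') (u := u) (by filter_upwards [hnhds] with s hs using hγ' s hs)
      (ht.1 ▸ hpe)
    filter_upwards [h1, h2, hnhds] with s hs1 hs2 hs
    exact ⟨by rw [mem_ofPred_eq, hs1, hs2, ht.1], hs⟩
  · rintro t ⟨htc, ht⟩
    refine ⟨?_, ht⟩
    have hc : ContinuousAt γ t := (hγ t ht).continuousAt
    have hc' : ContinuousAt γ' t := (hγ' t ht).continuousAt
    rw [mem_closure_iff_frequently] at htc
    by_contra hne
    have : ∀ᶠ s in 𝓝 t, γ s ≠ γ' s := (hc.ne_iff_eventually_ne hc').1 hne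
    exact htc (this.mono fun s hs hs' ↦ hs hs'.1)

end Flat
end Symplectic

/-- Connectedness of `ℝ`, in the form used to propagate local statements along a flow line. -/
theorem forall_of_eventually_iff {P : ℝ → Prop} (h : ∀ s, ∀ᶠ r in 𝓝 s, (P r ↔ P s)) (h₀ : P 0)
    (s : ℝ) : P s := by
  have hP : IsLocallyConstant P := IsLocallyConstant.iff_eventually_eq P |>.2 fun s ↦
    (h s).mono fun r hr ↦ propext hr
  exact (hP.apply_eq_of_preconnectedSpace s 0).symm ▸ h₀

/-! ### Commuting flows and completeness -/

namespace Symplectic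

section TimeOne

variable {m n : ℕ} {M : Type*} [TopologicalSpace M] [ChartedSpace (RSpace m) M]

open Classical in
/-- The time one map of the flow of a complete vector field. -/
def timeOneMap (Y : ∀ x : M, TangentSpace (𝓡 m) x) (x : M) : M :=
  if h : ∃ γ : ℝ → M, γ 0 = x ∧ IsMIntegralCurve (I := 𝓡 m) γ Y then h.choose 1 else x

/-- `θ` is smooth at `y` and its derivative maps the vectors `X u y` to `X u (θ y)`. -/
def PreservesFieldsAt (X : RSpace n → ∀ x : M, TangentSpace (𝓡 m) x) (θ : M → M) (y : M) : Prop :=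
  ContMDiffAt (𝓡 m) (𝓡 m) ∞ θ y ∧ ∀ w, mfderiv (𝓡 m) (𝓡 m) θ y (X w y) = X w (θ y)

variable {f : M → RSpace n} {X : RSpace n → ∀ x : M, TangentSpace (𝓡 m) x}
  {e : OpenPartialHomeomorph M (RSpace n × RSpace n)}

theorem PreservesFieldsAt.comp {θ θ' : M → M} {y : M} (hθ' : PreservesFieldsAt X θ' (θ y))
    (hθ : PreservesFieldsAt X θ y) : PreservesFieldsAt X (θ' ∘ θ) y := by
  refine ⟨hθ'.1.comp y hθ.1, fun w ↦ ?_⟩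
  rw [mfderiv_comp y (hθ'.1.mdifferentiableAt (by simp)) (hθ.1.mdifferentiableAt (by simp))]
  have h1 := hθ.2 w
  have h2 := hθ'.2 w
  rw [← h1] at h2
  exact h2

theorem PreservesFieldsAt.congr {θ θ' : M → M} {y : M} (hθ : PreservesFieldsAt X θ y)
    (h : θ' =ᶠ[𝓝 y] θ) : PreservesFieldsAt X θ' y := by
  refine ⟨hθ.1.congr_of_eventuallyEq h, fun w ↦ ?_⟩
  have h1 : HasMFDerivAt (𝓡 m) (𝓡 m) θ' y (mfderiv (𝓡 m) (𝓡 m) θ y) :=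
    ((hθ.1.mdifferentiableAt (by simp)).hasMFDerivAt).congr_of_eventuallyEq h
  have h2 := hθ.2 w
  have h3 := congrArg (fun l ↦ l (X w y)) h1.mfderiv
  rw [h.eq_of_nhds]
  exact h3.trans h2

/-- In the chart the map is a translation and the fields are constant, hence preserved. -/
theorem IsFlatChart.preservesFieldsAt_chartShift (he : IsFlatChart f X e) {y : M} {u : RSpace n}
    (hy : y ∈ e.source) (hyu : e y + (0, u) ∈ e.target) :
    PreservesFieldsAt X (chartShift e u) y := by
  have h1 : ContMDiffAt (𝓡 m) 𝓘(ℝ, RSpace n × RSpace n) ∞ e y :=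
    he.contMDiffOn.contMDiffAt (e.open_source.mem_nhds hy)
  have h2 : ContDiff ℝ ∞ fun z : RSpace n × RSpace n ↦ z + (0, u) := by fun_prop
  have h3 : ContMDiffAt 𝓘(ℝ, RSpace n × RSpace n) (𝓡 m) ∞ e.symm (e y + (0, u)) :=
    he.contMDiffOn_symm.contMDiffAt (e.open_target.mem_nhds hyu)
  have h23 : ContMDiffAt 𝓘(ℝ, RSpace n × RSpace n) (𝓡 m) ∞
      (e.symm ∘ fun z : RSpace n × RSpace n ↦ z + (0, u)) (e y) :=
    ContMDiffAt.comp (e y) h3 h2.contDiffAt.contMDiffAt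
  have h123 : ContMDiffAt (𝓡 m) (𝓡 m) ∞
      ((e.symm ∘ fun z : RSpace n × RSpace n ↦ z + (0, u)) ∘ e) y := ContMDiffAt.comp y h23 h1
  refine ⟨h123, fun w ↦ ?_⟩
  have d2 : HasMFDerivAt 𝓘(ℝ, RSpace n × RSpace n) 𝓘(ℝ, RSpace n × RSpace n)
      (fun z : RSpace n × RSpace n ↦ z + (0, u)) (e y) (ContinuousLinearMap.id ℝ _) :=
    ((hasFDerivAt_id (e y)).add_const ((0, u) : RSpace n × RSpace n)).hasMFDerivAt
  have d3 := HasMFDerivAt.comp (I' := 𝓘(ℝ, RSpace n × RSpace n)) (e y)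
    (h3.mdifferentiableAt (by simp)).hasMFDerivAt d2
  have d := HasMFDerivAt.comp y d3 (h1.mdifferentiableAt (by simp)).hasMFDerivAt
  have h4 := he.mfderiv_symm hyu w
  rw [← he.vectorDifferential_eq y hy w] at h4
  exact (congrArg (fun l ↦ l (X w y)) d.mfderiv).trans h4

theorem IsFlatFibration.isComplete_smul (h : IsFlatFibration f X) {u : RSpace n}
    (hu : IsCompleteVectorField (X u)) (s : ℝ) : IsCompleteVectorField (X (s • u)) := by
  intro x
  obtain ⟨γ, hγ0, hγ⟩ := hu x
  have h1 : s • X u = X (s • u) := funext fun x ↦ (h.map_smul s u x).symm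
  exact ⟨γ ∘ (· * s), by simp [hγ0], h1 ▸ hγ.comp_mul s⟩

theorem preservesFieldsAt_id (y : M) : PreservesFieldsAt X id y :=
  ⟨contMDiffAt_id, fun w ↦ by rw [mfderiv_id]; rfl⟩

theorem HasVelocityAt.preserved {c : ℝ → M} {t : ℝ} {u : RSpace n}
    (hc : HasVelocityAt c t (X u (c t))) {θ : M → M} (hθ : PreservesFieldsAt X θ (c t)) :
    HasVelocityAt (θ ∘ c) t (X u ((θ ∘ c) t)) :=
  (hc.comp (hθ.1.mdifferentiableAt (by simp))).congr_velocity (hθ.2 u)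

theorem HasVelocityAt.congr_field {Y : ∀ x : M, TangentSpace (𝓡 m) x} {c γ : ℝ → M} {t : ℝ}
    (hc : HasVelocityAt c t (Y (c t))) (h : γ =ᶠ[𝓝 t] c) : HasVelocityAt γ t (Y (γ t)) := by
  -- All tangent spaces are definitionally `RSpace m`, which allows values of `Y` at equal points to
  -- be compared without casts.
  have key (p q : M) (hpq : p = q) : (Y p : RSpace m) = Y q := by rw [hpq]
  refine (HasMFDerivAt.congr_of_eventuallyEq hc h).congr_mfderiv
    (ContinuousLinearMap.ext fun r ↦ ?_)
  exact congrArg (fun v : RSpace m ↦ r • v) (key _ _ h.eq_of_nhds.symm)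

variable [T2Space M]

theorem IsFlatFibration.timeOneMap_curve (h : IsFlatFibration f X) {γ : ℝ → M} {u : RSpace n}
    (hγ : IsMIntegralCurve (I := 𝓡 m) γ (X u)) (s t : ℝ) :
    timeOneMap (X (s • u)) (γ t) = γ (s + t) := by
  have h1 : s • X u = X (s • u) := funext fun x ↦ (h.map_smul s u x).symm
  have h2 : IsMIntegralCurve (I := 𝓡 m) ((γ ∘ (· + t)) ∘ (· * s)) (X (s • u)) :=
    h1 ▸ (hγ.comp_add t).comp_mul s
  have hex : ∃ γ' : ℝ → M, γ' 0 = γ t ∧ IsMIntegralCurve (I := 𝓡 m) γ' (X (s • u)) :=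
    ⟨_, by simp, h2⟩
  rw [timeOneMap, dif_pos hex]
  -- Any open interval around `[0, 1]` would do.
  have h3 := h.eqOn_Ioo (a := -2) (b := 2) (t₀ := 0) (by norm_num)
    (fun t _ ↦ hex.choose_spec.2 t) (fun t _ ↦ h2 t) (by simp [hex.choose_spec.1])
  simpa using h3 (x := 1) (by norm_num)

theorem IsFlatFibration.timeOneMap_add_smul (h : IsFlatFibration f X) {u : RSpace n}
    (hu : IsCompleteVectorField (X u)) (s t : ℝ) (x : M) :
    timeOneMap (X (s • u)) (timeOneMap (X (t • u)) x) = timeOneMap (X ((s + t) • u)) x := by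
  obtain ⟨γ, rfl, hγ⟩ := hu x
  simp only [h.timeOneMap_curve hγ, add_zero]

/-- Near a point the time one map of `X u`, for small `u`, is the translation by `(0, u)` in a flat
chart. -/
theorem IsFlatFibration.exists_timeOneMap_eq_chartShift (h : IsFlatFibration f X)
    (he : IsFlatChart f X e) {p : M} (hp : p ∈ e.source) :
    ∃ N ⊆ e.source, IsOpen N ∧ p ∈ N ∧ ∃ ε > 0, ∀ u : RSpace n, ‖u‖ < ε → ∀ q ∈ N,
      e q + (0, u) ∈ e.target ∧
        (IsCompleteVectorField (X u) → timeOneMap (X u) q = chartShift e u q) := by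
  obtain ⟨r, hr, hrt⟩ := Metric.isOpen_iff.1 e.open_target (e p) (e.map_source hp)
  -- For `|t| < 2` and `‖u‖ < r / 4` the displacement `t • u` is shorter than `r / 2`, so lines
  -- starting within `r / 2` of `e p` stay in the ball of radius `r` for times in `(-2, 2)`.
  refine ⟨e.source ∩ e ⁻¹' ball (e p) (r / 2), inter_subset_left,
    e.isOpen_inter_preimage isOpen_ball, ⟨hp, mem_ball_self (by positivity)⟩, r / 4, by positivity,
    fun u hu q hq ↦ ?_⟩
  have hmem (t : ℝ) (ht : t ∈ Ioo (-2 : ℝ) 2) : e q + t • (0, u) ∈ e.target := by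
    apply hrt
    have h1 : ‖t • ((0, u) : RSpace n × RSpace n)‖ < r / 2 := by
      rw [norm_smul, Prod.norm_mk, norm_zero, max_eq_right (norm_nonneg u), Real.norm_eq_abs]
      have : |t| < 2 := abs_lt.2 ht
      nlinarith [norm_nonneg u, abs_nonneg t]
    have h2 : ‖e q - e p‖ < r / 2 := mem_ball_iff_norm.1 hq.2
    rw [mem_ball_iff_norm, add_sub_right_comm]
    linarith [norm_add_le (e q - e p) (t • ((0, u) : RSpace n × RSpace n))]
  refine ⟨by simpa using hmem 1 (by norm_num), fun hc ↦ ?_⟩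
  obtain ⟨γ, hγ0, hγ⟩ := hc q
  have h1 := h.timeOneMap_curve hγ 1 0
  rw [one_smul, hγ0, add_zero] at h1
  rw [h1]
  have h3 := h.eqOn_Ioo (a := -2) (b := 2) (t₀ := 0) (γ := γ)
    (γ' := fun s ↦ e.symm (e q + s • (0, u))) (by norm_num)
    (fun t _ ↦ hγ t) (fun t ht ↦ he.hasVelocityAt_symm (hmem t ht)) (by simp [hγ0, e.left_inv hq.1])
  simpa [chartShift] using h3 (x := 1) (by norm_num)

theorem IsFlatFibration.timeOneMap_zero (h : IsFlatFibration f X) (x : M) :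
    timeOneMap (X 0) x = x := by
  have h0 (y : M) : X 0 y = 0 := by simpa using h.map_smul 0 0 y
  have h1 := h.timeOneMap_curve (γ := fun _ ↦ x) (u := 0) (isMIntegralCurve_const (h0 x)) 1 0
  rwa [one_smul] at h1

theorem IsFlatFibration.preservesFieldsAt_timeOneMap (h : IsFlatFibration f X) {u : RSpace n}
    (hu : IsCompleteVectorField (X u)) (y : M) : PreservesFieldsAt X (timeOneMap (X u)) y := by
  -- For `r` near `s`, the flows for times `r` and `s` differ by a short flow near `γ s`, which is a
  -- chart translation and preserves the fields. Hence the property at one time is equivalent to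
  -- that at the other.
  have key := forall_of_eventually_iff (P := fun s ↦ PreservesFieldsAt X (timeOneMap (X (s • u))) y)
    (fun s ↦ ?_) ?_ 1
  · simpa using key
  · obtain ⟨γ, hγ0, hγ⟩ := hu y
    have hγs (s : ℝ) : timeOneMap (X (s • u)) y = γ s := by
      rw [← hγ0, h.timeOneMap_curve hγ, add_zero]
    obtain ⟨e, hpe, he⟩ := h.exists_chart (γ s)
    obtain ⟨N, hNe, hN, hpN, ε, hε, hloc⟩ := h.exists_timeOneMap_eq_chartShift he hpe
    have h1 : ∀ᶠ r in 𝓝 s, γ r ∈ N := hγ.continuous.continuousAt.eventually_mem (hN.mem_nhds hpN)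
    have h2 : ∀ᶠ r in 𝓝 s, ‖(r - s) • u‖ < ε := by
      have : ContinuousAt (fun r : ℝ ↦ ‖(r - s) • u‖) s := by fun_prop
      exact this.eventually_lt continuousAt_const (by simpa using hε)
    have hgood {v : RSpace n} (hv : ‖v‖ < ε) (hc : IsCompleteVectorField (X v)) {q : M}
        (hq : q ∈ N) : PreservesFieldsAt X (timeOneMap (X v)) q := by
      refine (he.preservesFieldsAt_chartShift (hNe hq) (hloc v hv q hq).1).congr ?_
      filter_upwards [hN.mem_nhds hq] with z hz using (hloc v hv z hz).2 hc
    filter_upwards [h1, h2] with r hr1 hr2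
    constructor
    · intro hP
      have h3 : timeOneMap (X (s • u)) = timeOneMap (X ((s - r) • u)) ∘ timeOneMap (X (r • u)) := by
        ext x
        rw [Function.comp_apply, h.timeOneMap_add_smul hu, sub_add_cancel]
      rw [h3]
      refine PreservesFieldsAt.comp (hgood ?_ (h.isComplete_smul hu _) ?_) hP
      · rwa [← neg_sub, neg_smul, norm_neg]
      · rwa [hγs]
    · intro hP
      have h3 : timeOneMap (X (r • u)) = timeOneMap (X ((r - s) • u)) ∘ timeOneMap (X (s • u)) := by
        ext x
        rw [Function.comp_apply, h.timeOneMap_add_smul hu, sub_add_cancel]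
      rw [h3]
      exact PreservesFieldsAt.comp (hgood hr2 (h.isComplete_smul hu _) (by rwa [hγs])) hP
  · have : timeOneMap (X ((0 : ℝ) • u)) = id := by
      ext x
      rw [zero_smul, h.timeOneMap_zero, id]
    rw [this]
    exact preservesFieldsAt_id y

/-- If `X u` and `X w` are complete, then `X (u + w)` has the integral curve
`t ↦ φₜ (ψₜ x)`, where `φ` and `ψ` are the flows of `X u` and of `X w`. -/
theorem IsFlatFibration.isMIntegralCurve_add (h : IsFlatFibration f X) {u w : RSpace n}
    (hu : IsCompleteVectorField (X u)) (hw : IsCompleteVectorField (X w)) (x : M) :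
    IsMIntegralCurve (I := 𝓡 m)
      (fun t ↦ timeOneMap (X (t • u)) (timeOneMap (X (t • w)) x)) (X (u + w)) := by
  intro t₀
  set z := timeOneMap (X (t₀ • w)) x with hz
  obtain ⟨e, hpe, he⟩ := h.exists_chart z
  obtain ⟨N, hNe, hN, hpN, ε, hε, hloc⟩ := h.exists_timeOneMap_eq_chartShift he hpe
  -- Near `t₀` the curve is the image under the flow `φ` of `X u`, for the fixed time `t₀`, of `c`:
  -- both short flows over `t - t₀` are translations in the chart and combine to the line with
  -- direction `(0, u + w)` through `e z`. As `φ` preserves the fields, the image has the same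
  -- velocity field as `c`.
  let y := e z - t₀ • ((0, u + w) : RSpace n × RSpace n)
  have hy : y + t₀ • ((0, u + w) : RSpace n × RSpace n) = e z := sub_add_cancel _ _
  let c : ℝ → M := fun s ↦ e.symm (y + s • (0, u + w))
  have hc₀ : c t₀ = z := by simp only [c, hy, e.left_inv hpe]
  have hc : HasVelocityAt c t₀ (X (u + w) (c t₀)) :=
    he.hasVelocityAt_symm (by rw [hy]; exact e.map_source hpe)
  have hvel := hc.preserved (θ := timeOneMap (X (t₀ • u)))
    (h.preservesFieldsAt_timeOneMap (h.isComplete_smul hu t₀) _)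
  refine hvel.congr_field ?_
  have hsmall (v : RSpace n) : ∀ᶠ t in 𝓝 t₀, ‖(t - t₀) • v‖ < ε := by
    have : ContinuousAt (fun r : ℝ ↦ ‖(r - t₀) • v‖) t₀ := by fun_prop
    exact this.eventually_lt continuousAt_const (by simpa using hε)
  obtain ⟨γ, hγ0, hγ⟩ := hw x
  have hγs (s : ℝ) : timeOneMap (X (s • w)) x = γ s := by
    rw [← hγ0, h.timeOneMap_curve hγ, add_zero]
  have hN' : ∀ᶠ t in 𝓝 t₀, γ t ∈ N :=
    hγ.continuous.continuousAt.eventually_mem (hN.mem_nhds (by rwa [← hγs]))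
  filter_upwards [hsmall u, hsmall w, hN'] with t htu htw htN
  have h1 : timeOneMap (X (t • w)) x = timeOneMap (X ((t - t₀) • w)) z := by
    rw [hz, h.timeOneMap_add_smul hw, sub_add_cancel]
  have h2 : timeOneMap (X ((t - t₀) • w)) z = e.symm (e z + (0, (t - t₀) • w)) :=
    (hloc _ htw z hpN).2 (h.isComplete_smul hw _)
  have h3 : timeOneMap (X ((t - t₀) • w)) z ∈ N := by rwa [← h1, hγs]
  have h4 := (hloc _ htu _ h3).2 (h.isComplete_smul hu _)
  have h5 : e (timeOneMap (X ((t - t₀) • w)) z) = e z + (0, (t - t₀) • w) := by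
    rw [h2, e.right_inv (hloc _ htw z hpN).1]
  rw [h1, Function.comp_apply]
  have h6 : timeOneMap (X ((t - t₀) • u)) (timeOneMap (X ((t - t₀) • w)) z) = c t := by
    rw [h4, chartShift, h5]
    simp only [c, y]
    congr 1
    ext i <;> simp
    ring
  rw [← h6, h.timeOneMap_add_smul hu]
  congr 3
  ring

theorem IsFlatFibration.isComplete_add (h : IsFlatFibration f X) {u w : RSpace n}
    (hu : IsCompleteVectorField (X u)) (hw : IsCompleteVectorField (X w)) :
    IsCompleteVectorField (X (u + w)) := fun x ↦
  ⟨_, by simp [h.timeOneMap_zero], h.isMIntegralCurve_add hu hw x⟩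

theorem IsFlatFibration.timeOneMap_add (h : IsFlatFibration f X) {u w : RSpace n}
    (hu : IsCompleteVectorField (X u)) (hw : IsCompleteVectorField (X w)) (x : M) :
    timeOneMap (X (u + w)) x = timeOneMap (X u) (timeOneMap (X w) x) := by
  have h1 := h.timeOneMap_curve (h.isMIntegralCurve_add hu hw x) 1 0
  simpa [h.timeOneMap_zero] using h1

/-- Completeness passes to sums because the flows compose to an integral curve of the sum; induction
over the coordinates of `u` does the rest. -/
theorem IsFlatFibration.isComplete (h : IsFlatFibration f X)
    (hc : ∀ i, IsCompleteVectorField (X (EuclideanSpace.single i 1))) (u : RSpace n) :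
    IsCompleteVectorField (X u) := by
  have hsum (s : Finset (Fin n)) :
      IsCompleteVectorField (X (∑ i ∈ s, u i • EuclideanSpace.single i 1)) := by
    induction s using Finset.induction_on with
    | empty =>
      intro x
      refine ⟨fun _ ↦ x, rfl, isMIntegralCurve_const ?_⟩
      simpa using h.map_smul 0 0 x
    | insert i s hi ih =>
      rw [Finset.sum_insert hi]
      exact h.isComplete_add (h.isComplete_smul (hc i) _) ih
  have hu : ∑ i, u i • EuclideanSpace.single i (1 : ℝ) = u := by
    ext j
    simp [Finset.sum_apply, Pi.single_apply]
  exact hu ▸ hsum Finset.univ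

/-- In a flat chart the flow moves only the second coordinate, while `f` is the first. -/
theorem IsFlatFibration.apply_timeOneMap (h : IsFlatFibration f X) {u : RSpace n}
    (hu : IsCompleteVectorField (X u)) (x : M) : f (timeOneMap (X u) x) = f x := by
  obtain ⟨γ, rfl, hγ⟩ := hu x
  have h1 := h.timeOneMap_curve hγ 1 0
  rw [one_smul, add_zero] at h1
  rw [h1]
  refine forall_of_eventually_iff (P := fun s ↦ f (γ s) = f (γ 0)) (fun s ↦ ?_) rfl 1
  obtain ⟨e, hpe, he⟩ := h.exists_chart (γ s)
  have hcont : ContinuousAt (fun t : ℝ ↦ e (γ s) + (t - s) • ((0, u) : RSpace n × RSpace n)) s := by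
    fun_prop
  have htarget := hcont.eventually_mem (e.open_target.mem_nhds (by simpa using e.map_source hpe))
  filter_upwards [he.eventually_eq (hγ.isMIntegralCurveAt s) hpe, htarget] with t ht ht'
  have h2 : f (γ t) = f (γ s) := by
    rw [ht, ← he.fst_eq _ (e.map_target ht'), e.right_inv ht', ← he.fst_eq _ hpe]
    simp
  rw [h2]

end TimeOne
end Symplectic

/-! ### Coverings of simply connected spaces and orbit maps -/

/-- A covering map from a path connected space to a simply connected one is injective. -/
theorem IsCoveringMap.injective_of_simplyConnectedSpace {E Y : Type*} [TopologicalSpace E]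
    [TopologicalSpace Y] [PathConnectedSpace E] [SimplyConnectedSpace Y] {p : E → Y}
    (hp : IsCoveringMap p) : Function.Injective p := by
  intro u v huv
  let γ : Path u v := PathConnectedSpace.somePath u v
  -- A path joining two points over the same base point projects to a null-homotopic loop, so its
  -- lift ends where the constant lift ends.
  have hom := SimplyConnectedSpace.paths_homotopic (γ.map hp.continuous)
    ((Path.refl (p u)).cast rfl huv.symm)
  have h1 := hp.liftPath_apply_one_eq_of_homotopicRel hom u (by simp) (by simp)
  have h2 : γ.toContinuousMap
      = hp.liftPath (γ.map hp.continuous).toContinuousMap u (by simp) :=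
    (hp.eq_liftPath_iff' _).2 ⟨rfl, γ.source⟩
  have h3 : ContinuousMap.const unitInterval u
      = hp.liftPath ((Path.refl (p u)).cast rfl huv.symm).toContinuousMap u (by simp) :=
    (hp.eq_liftPath_iff' _).2 ⟨rfl, rfl⟩
  rw [← h2, ← h3] at h1
  exact (γ.target.symm.trans h1).symm

/-- The orbit map of a transitive and locally free action of a vector space on a simply connected
space is injective. -/
theorem injective_of_isOpenMap_of_add {V Y : Type*} [NormedAddCommGroup V] [NormedSpace ℝ V]
    [TopologicalSpace Y] [SimplyConnectedSpace Y] {p : V → Y} (hcont : Continuous p)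
    (hopen : IsOpenMap p) (hsurj : Function.Surjective p)
    (hadd : ∀ u v w, p u = p v → p (w + u) = p (w + v))
    (hfree : ∃ ε > 0, ∀ u, ‖u‖ < ε → p u = p 0 → u = 0) : Function.Injective p := by
  -- `G` is the stabilizer of `p 0`. It is discrete by local freeness, and `p` is the quotient map
  -- by it, hence a covering.
  let G : AddSubgroup V :=
    { carrier := {u | p u = p 0}
      zero_mem' := rfl
      add_mem' := fun {u v} hu hv ↦ by
        have h1 := hadd v 0 u hv
        rw [add_zero] at h1
        exact h1.trans hu
      neg_mem' := fun {u} hu ↦ by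
        have h1 := hadd u 0 (-u) hu
        rw [neg_add_cancel, add_zero] at h1
        exact h1.symm }
  have hG : IsDiscrete (G : Set V) := by
    obtain ⟨ε, hε, hfree⟩ := hfree
    refine isDiscrete_iff_forall_mem_exists_isOpen.2 fun y hy ↦ ⟨ball y ε, isOpen_ball, ?_⟩
    refine Subset.antisymm (fun z hz ↦ ?_) (singleton_subset_iff.2 ⟨mem_ball_self hε, hy⟩)
    exact sub_eq_zero.1 (hfree (z - y) (mem_ball_iff_norm.1 hz.1) (G.sub_mem hz.2 hy))
  have hq := (IsOpenQuotientMap.mk hsurj hcont hopen).isQuotientMap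
  refine (hq.isAddQuotientCoveringMap_of_addSubgroup G hG fun {u v} ↦
    ⟨fun h ↦ ?_, fun h ↦ ?_⟩).isCoveringMap.injective_of_simplyConnectedSpace
  · have h1 := hadd v u (-u) h.symm
    rw [neg_add_cancel, neg_add_eq_sub, sub_eq_add_neg] at h1
    exact h1
  · have h1 := hadd (v + -u) 0 u h
    rw [add_zero, add_comm v, add_neg_cancel_left] at h1
    exact h1.symm

/-! ### Simple transitivity on the fibers -/

namespace Symplectic

variable {m n : ℕ} {M : Type*} [TopologicalSpace M] [ChartedSpace (RSpace m) M]
  {f : M → RSpace n} {X : RSpace n → ∀ x : M, TangentSpace (𝓡 m) x}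
  {e : OpenPartialHomeomorph M (RSpace n × RSpace n)} [T2Space M]

/-- The group law moves the question from `u₀` to the small vector `u - u₀` acting at `timeOneMap (X
u₀) x`, where the flow is a chart translation. -/
theorem IsFlatFibration.continuous_timeOneMap (h : IsFlatFibration f X)
    (hc : ∀ u, IsCompleteVectorField (X u)) (x : M) :
    Continuous fun u ↦ timeOneMap (X u) x := by
  refine continuous_iff_continuousAt.2 fun u₀ ↦ ?_
  obtain ⟨e, hpe, he⟩ := h.exists_chart (timeOneMap (X u₀) x)
  obtain ⟨N, hNe, hN, hpN, ε, hε, hloc⟩ := h.exists_timeOneMap_eq_chartShift he hpe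
  set y := timeOneMap (X u₀) x with hy
  have hcont : ContinuousAt (fun u ↦ e.symm (e y + (0, u - u₀))) u₀ := by
    have h1 : ContinuousAt (fun u ↦ e y + ((0, u - u₀) : RSpace n × RSpace n)) u₀ := by fun_prop
    refine ContinuousAt.comp (g := e.symm) (e.continuousAt_symm ?_) h1
    rw [sub_self]
    exact (hloc 0 (by simpa using hε) y hpN).1
  refine hcont.congr ?_
  filter_upwards [ball_mem_nhds u₀ hε] with u hu
  have h2 := (hloc (u - u₀) (mem_ball_iff_norm.1 hu) y hpN).2 (hc _)
  rw [← chartShift, ← h2, hy, ← h.timeOneMap_add (hc _) (hc _), sub_add_cancel]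

/-- Points of the same fiber are related by the flows, if they are close. -/
theorem IsFlatFibration.eventually_exists_timeOneMap_eq (h : IsFlatFibration f X)
    (hc : ∀ u, IsCompleteVectorField (X u)) (y : M) {δ : ℝ} (hδ : 0 < δ) :
    ∀ᶠ q in 𝓝 y, f q = f y → ∃ u, ‖u‖ < δ ∧ timeOneMap (X u) y = q := by
  obtain ⟨e, hpe, he⟩ := h.exists_chart y
  obtain ⟨N, hNe, hN, hpN, ε, hε, hloc⟩ := h.exists_timeOneMap_eq_chartShift he hpe
  have h1 : ∀ᶠ q in 𝓝 y, e q ∈ ball (e y) (min ε δ) :=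
    (e.continuousAt hpe).eventually_mem (ball_mem_nhds _ (lt_min hε hδ))
  filter_upwards [h1, hN.mem_nhds hpN] with q hq hqN hfq
  have h2 : ‖(e q).2 - (e y).2‖ < min ε δ :=
    (norm_snd_le (e q - e y)).trans_lt (mem_ball_iff_norm.1 hq)
  refine ⟨(e q).2 - (e y).2, h2.trans_le (min_le_right _ _), ?_⟩
  rw [(hloc _ (h2.trans_le (min_le_left _ _)) y hpN).2 (hc _), chartShift]
  have h3 : e y + (0, (e q).2 - (e y).2) = e q := by
    refine Prod.ext ?_ ?_
    · rw [Prod.fst_add, add_zero, he.fst_eq _ hpe, he.fst_eq _ (hNe hqN), hfq]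
    · rw [Prod.snd_add, add_sub_cancel]
  rw [h3, e.left_inv (hNe hqN)]

theorem IsFlatFibration.exists_forall_timeOneMap_ne (h : IsFlatFibration f X)
    (hc : ∀ u, IsCompleteVectorField (X u)) (y : M) :
    ∃ ε > 0, ∀ u, ‖u‖ < ε → timeOneMap (X u) y = y → u = 0 := by
  obtain ⟨e, hpe, he⟩ := h.exists_chart y
  obtain ⟨N, hNe, hN, hpN, ε, hε, hloc⟩ := h.exists_timeOneMap_eq_chartShift he hpe
  refine ⟨ε, hε, fun u hu hy ↦ ?_⟩
  rw [(hloc u hu y hpN).2 (hc _), chartShift] at hy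
  have h1 := e.right_inv (hloc u hu y hpN).1
  rw [hy] at h1
  exact (Prod.ext_iff.1 (left_eq_add.1 h1)).2

/-- The flows act simply transitively on each fiber. -/
theorem IsFlatFibration.existsUnique_timeOneMap_eq (h : IsFlatFibration f X)
    (hc : ∀ u, IsCompleteVectorField (X u)) {x y : M} (hs : SimplyConnectedSpace (f ⁻¹' {f x}))
    (hxy : f y = f x) : ∃! u, timeOneMap (X u) x = y := by
  let p (u : RSpace n) : f ⁻¹' {f x} := ⟨timeOneMap (X u) x, h.apply_timeOneMap (hc u) x⟩
  have hadd (u w : RSpace n) : timeOneMap (X (u + w)) x = timeOneMap (X u) (p w) :=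
    h.timeOneMap_add (hc u) (hc w) x
  have hcont : Continuous p := (h.continuous_timeOneMap hc x).subtype_mk _
  have hnear (q : f ⁻¹' {f x}) {δ : ℝ} (hδ : 0 < δ) :
      ∀ᶠ q' : f ⁻¹' {f x} in 𝓝 q, ∃ u, ‖u‖ < δ ∧ timeOneMap (X u) (q : M) = q' := by
    filter_upwards [continuous_subtype_val.continuousAt.eventually
      (h.eventually_exists_timeOneMap_eq hc q hδ)] with q' hq'
    exact hq' (q'.2.trans q.2.symm)
  have hopen : IsOpenMap p := by
    refine isOpenMap_iff_nhds_le.2 fun u ↦ ?_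
    intro s hs
    obtain ⟨δ, hδ, hδs⟩ := Metric.mem_nhds_iff.1 (mem_map.1 hs)
    filter_upwards [hnear (p u) hδ] with q' hq'
    obtain ⟨w, hw, hwq⟩ := hq'
    have h1 : p (w + u) = q' := Subtype.ext ((hadd w u).trans hwq)
    rw [← h1]
    exact hδs (by simpa using hw)
  have hsurj : Function.Surjective p := by
    -- A point of the orbit close to `q` is reached from `q` by some flow; reversing this flow puts
    -- `q` itself in the orbit. The orbit is thus open and closed in a connected fiber.
    have hclosed : IsClosed (range p) := by
      refine ⟨isOpen_iff_mem_nhds.2 fun q hq ↦ ?_⟩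
      filter_upwards [hnear q one_pos] with q' hq'
      rintro ⟨w, rfl⟩
      obtain ⟨u, -, hu⟩ := hq'
      refine hq ⟨-u + w, Subtype.ext ((hadd _ _).trans ?_)⟩
      rw [← hu, ← h.timeOneMap_add (hc _) (hc _), neg_add_cancel, h.timeOneMap_zero]
    exact range_eq_univ.1 (IsClopen.eq_univ ⟨hclosed, hopen.isOpen_range⟩ (range_nonempty p))
  have hp0 : (p 0 : M) = x := h.timeOneMap_zero x
  have hinj : Function.Injective p := by
    refine injective_of_isOpenMap_of_add hcont hopen hsurj (fun u v w huv ↦ ?_) ?_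
    · exact Subtype.ext ((hadd w u).trans (huv ▸ (hadd w v).symm))
    · obtain ⟨ε, hε, hfree⟩ := h.exists_forall_timeOneMap_ne hc x
      exact ⟨ε, hε, fun u hu hu0 ↦ hfree u hu ((congrArg Subtype.val hu0).trans hp0)⟩
  obtain ⟨u, hu⟩ := hsurj ⟨y, hxy⟩
  exact ⟨u, congrArg Subtype.val hu, fun u' hu' ↦ hinj (Subtype.ext hu' |>.trans hu.symm)⟩

end Symplectic

/-! ### Global equivariant fiber coordinates -/

namespace Symplectic

variable {m n : ℕ} {M : Type*} [TopologicalSpace M] [ChartedSpace (RSpace m) M]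
  {f : M → RSpace n} {X : RSpace n → ∀ x : M, TangentSpace (𝓡 m) x}

/-- The pullback of a smooth partition of unity by a smooth map. -/
def pullbackPartitionOfUnity {ι : Type*} {B : TopologicalSpace.Opens (RSpace n)}
    (ρ : SmoothPartitionOfUnity ι (𝓡 n) B) {φ : M → B} (hφ : ContMDiff (𝓡 m) (𝓡 n) ∞ φ) :
    SmoothPartitionOfUnity ι (𝓡 m) M where
  toFun i := ⟨fun x ↦ ρ i (φ x), (ρ i).contMDiff.comp hφ⟩
  locallyFinite' := ρ.locallyFinite.preimage_continuous hφ.continuous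
  nonneg' i x := ρ.nonneg i (φ x)
  sum_eq_one' x _ := ρ.sum_eq_one (mem_univ (φ x))
  sum_le_one' x := ρ.sum_le_one (φ x)

theorem IsFlatChart.contMDiffOn_section {e : OpenPartialHomeomorph M (RSpace n × RSpace n)}
    (he : IsFlatChart f X e) (c : RSpace n) :
    ContMDiffOn (𝓡 n) (𝓡 m) ∞ (fun b ↦ e.symm (b, c)) {b | (b, c) ∈ e.target} := by
  have h1 : ContDiff ℝ ∞ fun b : RSpace n ↦ (b, c) := by fun_prop
  exact he.contMDiffOn_symm.comp h1.contMDiff.contMDiffOn fun b hb ↦ hb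

variable [T2Space M]

/-- Moving `s` by the fixed flow with parameter `t x₀` yields a smooth map `F` with `F x₀ = x₀`. In
a flat chart at `x₀` the remaining time is the difference of the second coordinates of `x` and `F
x`; uniqueness of times identifies `t` with this difference plus `t x₀`. -/
theorem IsFlatFibration.contMDiffAt_of_timeOneMap_eq (h : IsFlatFibration f X)
    (hc : ∀ u, IsCompleteVectorField (X u))
    (hunique : ∀ x y, f y = f x → ∃! u, timeOneMap (X u) x = y) {s : M → M} {t : M → RSpace n}
    {x₀ : M} (hs : ContMDiffAt (𝓡 m) (𝓡 m) ∞ s x₀) (hfs : ∀ᶠ x in 𝓝 x₀, f (s x) = f x)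
    (ht : ∀ᶠ x in 𝓝 x₀, timeOneMap (X (t x)) (s x) = x) : ContMDiffAt (𝓡 m) (𝓡 n) ∞ t x₀ := by
  obtain ⟨e, hpe, he⟩ := h.exists_chart x₀
  obtain ⟨N, hNe, hN, hpN, ε, hε, hloc⟩ := h.exists_timeOneMap_eq_chartShift he hpe
  let F : M → M := timeOneMap (X (t x₀)) ∘ s
  have hF₀ : F x₀ = x₀ := ht.self_of_nhds
  have hF : ContMDiffAt (𝓡 m) (𝓡 m) ∞ F x₀ :=
    ContMDiffAt.comp x₀ (h.preservesFieldsAt_timeOneMap (hc _) _).1 hs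
  have he₀ : ContMDiffAt (𝓡 m) 𝓘(ℝ, RSpace n × RSpace n) ∞ e x₀ :=
    he.contMDiffOn.contMDiffAt (e.open_source.mem_nhds hpe)
  have heF : ContMDiffAt (𝓡 m) 𝓘(ℝ, RSpace n × RSpace n) ∞ (e ∘ F) x₀ :=
    ContMDiffAt.comp x₀ (hF₀.symm ▸ he₀) hF
  have hsnd : ContDiff ℝ ∞ (Prod.snd : RSpace n × RSpace n → RSpace n) := contDiff_snd
  let d : M → RSpace n := fun x ↦ (e x).2 - (e (F x)).2
  have h1 : ContMDiffAt (𝓡 m) (𝓡 n) ∞ (Prod.snd ∘ e) x₀ :=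
    ContMDiffAt.comp x₀ hsnd.contDiffAt.contMDiffAt he₀
  have h2 : ContMDiffAt (𝓡 m) (𝓡 n) ∞ (Prod.snd ∘ e ∘ F) x₀ :=
    ContMDiffAt.comp x₀ hsnd.contDiffAt.contMDiffAt heF
  have hd : ContMDiffAt (𝓡 m) (𝓡 n) ∞ d x₀ := h1.sub h2
  have hd₀ : d x₀ = 0 := by simp only [d, hF₀, sub_self]
  refine (hd.add (contMDiffAt_const (c := t x₀))).congr_of_eventuallyEq ?_
  have hdε : ∀ᶠ x in 𝓝 x₀, ‖d x‖ < ε :=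
    hd.continuousAt.norm.eventually_lt continuousAt_const (by simpa [hd₀] using hε)
  have hFN : ∀ᶠ x in 𝓝 x₀, F x ∈ N :=
    hF.continuousAt.eventually_mem (hF₀.symm ▸ hN.mem_nhds hpN)
  filter_upwards [hdε, hFN, hN.mem_nhds hpN, hfs, ht] with x hx hxF hxN hfx htx
  refine (hunique (s x) x hfx.symm).unique htx ?_
  change timeOneMap (X (d x + t x₀)) (s x) = x
  rw [h.timeOneMap_add (hc _) (hc _)]
  change timeOneMap (X (d x)) (F x) = x
  rw [(hloc _ hx _ hxF).2 (hc _), chartShift]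
  have h3 : e (F x) + (0, d x) = e x := by
    refine Prod.ext ?_ ?_
    · rw [Prod.fst_add, add_zero, he.fst_eq _ (hNe hxF), he.fst_eq _ (hNe hxN), ← hfx]
      exact h.apply_timeOneMap (hc _) _
    · rw [Prod.snd_add, add_sub_cancel]
  rw [h3, e.left_inv (hNe hxN)]

/-- If the flows act simply transitively on the fibers of `f`, then there are fiber coordinates in
which they act by translations. -/
theorem IsFlatFibration.exists_equivariant (h : IsFlatFibration f X)
    (hc : ∀ u, IsCompleteVectorField (X u))
    (hunique : ∀ x y, f y = f x → ∃! u, timeOneMap (X u) x = y)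
    (hf : ContMDiff (𝓡 m) (𝓡 n) ∞ f) {B : TopologicalSpace.Opens (RSpace n)}
    (hB : ∀ x, f x ∈ B) (hsurj : ∀ b ∈ B, ∃ x, f x = b) :
    ∃ g : M → RSpace n, ContMDiff (𝓡 m) (𝓡 n) ∞ g ∧
      ∀ u x, g (timeOneMap (X u) x) = g x + u := by
  let φ (x : M) : B := ⟨f x, hB x⟩
  have hφ : ContMDiff (𝓡 m) (𝓡 n) ∞ φ := (ContMDiff.subtypeVal_comp_iff B φ).1 hf
  -- Local sections arise by freezing the second coordinate of a flat chart.
  have hsec (b : B) : ∃ (V : Set (RSpace n)) (σ : RSpace n → M), IsOpen V ∧ (b : RSpace n) ∈ V ∧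
      ContMDiffOn (𝓡 n) (𝓡 m) ∞ σ V ∧ ∀ b' ∈ V, f (σ b') = b' := by
    obtain ⟨p, hp⟩ := hsurj b b.2
    obtain ⟨e, hpe, he⟩ := h.exists_chart p
    refine ⟨{b' | (b', (e p).2) ∈ e.target}, fun b' ↦ e.symm (b', (e p).2),
      e.open_target.preimage (by fun_prop), ?_, he.contMDiffOn_section _, fun b' hb' ↦ ?_⟩
    · have h1 : ((b : RSpace n), (e p).2) = e p :=
        Prod.ext (hp.symm.trans (he.fst_eq p hpe).symm) rfl
      rw [mem_ofPred_eq, h1]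
      exact e.map_source hpe
    · rw [← he.fst_eq _ (e.map_target hb'), e.right_inv hb']
  choose V σ hVo hbV hσ hfσ using hsec
  have : LocallyCompactSpace B := B.isOpen.locallyCompactSpace
  obtain ⟨ρ, hρ⟩ := SmoothPartitionOfUnity.exists_isSubordinate (𝓡 n) (M := B) isClosed_univ
    (fun b : B ↦ (Subtype.val ⁻¹' V b : Set B))
    (fun b ↦ (hVo b).preimage continuous_subtype_val) (fun b _ ↦ mem_iUnion.2 ⟨b, hbV b⟩)
  let P := pullbackPartitionOfUnity ρ hφ
  have hP : P.IsSubordinate fun b ↦ f ⁻¹' V b := fun b x hx ↦ by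
    have h1 : tsupport (P b) ⊆ φ ⁻¹' tsupport (ρ b) :=
      closure_minimal (fun y hy ↦ subset_tsupport _ hy)
        ((isClosed_tsupport _).preimage hφ.continuous)
    exact hρ b (h1 hx)
  -- The time from the section to `x`. Its value is arbitrary for `f x ∉ V b`, which is harmless as
  -- the weight `P b` vanishes there.
  let t (b : B) (x : M) : RSpace n := Classical.epsilon fun u ↦ timeOneMap (X u) (σ b (f x)) = x
  have ht (b : B) (x : M) (hx : f x ∈ V b) : timeOneMap (X (t b x)) (σ b (f x)) = x :=
    Classical.epsilon_spec (hunique _ x (hfσ b _ hx).symm).exists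
  have hopen (b : B) : IsOpen (f ⁻¹' V b) := (hVo b).preimage hf.continuous
  have hsmooth (b : B) : ContMDiffOn (𝓡 m) (𝓡 n) ∞ (t b) (f ⁻¹' V b) := by
    intro x hx
    have hnhds := (hopen b).mem_nhds hx
    refine (h.contMDiffAt_of_timeOneMap_eq hc hunique (s := fun x ↦ σ b (f x)) ?_ ?_
      ?_).contMDiffWithinAt
    · exact ContMDiffAt.comp x ((hσ b).contMDiffAt ((hVo b).mem_nhds hx)) (hf x)
    · filter_upwards [hnhds] with y hy using hfσ b _ hy
    · filter_upwards [hnhds] with y hy using ht b y hy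
  -- Each `t b` increases by `u` under the flow of `X u`; the average does too, because the weights
  -- depend only on `f x` and sum to one.
  refine ⟨fun x ↦ ∑ᶠ b, P b x • t b x, hP.contMDiff_finsum_smul hopen hsmooth, fun u x ↦ ?_⟩
  have hφu : φ (timeOneMap (X u) x) = φ x := Subtype.ext (h.apply_timeOneMap (hc u) x)
  have hPu (b : B) : P b (timeOneMap (X u) x) = P b x := congrArg (ρ b) hφu
  have hterm (b : B) : P b (timeOneMap (X u) x) • t b (timeOneMap (X u) x)
      = P b x • (t b x + u) := by
    rw [hPu]
    by_cases hb : P b x = 0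
    · rw [hb, zero_smul, zero_smul]
    have hx : f x ∈ V b := hP b (subset_tsupport _ hb)
    have hfu : f (timeOneMap (X u) x) = f x := h.apply_timeOneMap (hc u) x
    have h1 := ht b (timeOneMap (X u) x) (by rwa [hfu])
    rw [hfu] at h1
    have h2 : timeOneMap (X (t b x + u)) (σ b (f x)) = timeOneMap (X u) x := by
      rw [add_comm, h.timeOneMap_add (hc _) (hc _), ht b x hx]
    rw [(hunique (σ b (f x)) (timeOneMap (X u) x) (by rw [hfu, hfσ b _ hx])).unique h1 h2]
  simp only [hterm]
  rw [← P.sum_finsupport_smul_eq_finsum x t, ← P.sum_finsupport_smul_eq_finsum x fun b y ↦ t b y + u]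
  simp only [smul_add]
  rw [Finset.sum_add_distrib, ← Finset.sum_smul, P.sum_finsupport x (mem_univ x), one_smul]

/-- Equivariance makes `g` affine with slope `u` along the integral curves of `X u`. -/
theorem IsFlatFibration.vectorDifferential_equivariant (h : IsFlatFibration f X) {u : RSpace n}
    (hu : IsCompleteVectorField (X u)) {g : M → RSpace n}
    (hg : MDifferentiable (𝓡 m) (𝓡 n) g) (hgX : ∀ s : ℝ, ∀ x,
      g (timeOneMap (X (s • u)) x) = g x + s • u) (x : M) :
    vectorDifferential m g x (X u x) = u := by
  obtain ⟨γ, rfl, hγ⟩ := hu x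
  have h1 : HasDerivAt (g ∘ γ) (vectorDifferential m g (γ 0) (X u (γ 0))) 0 :=
    HasVelocityAt.hasDerivAt_comp (hγ 0) (hg (γ 0))
  have h2 : g ∘ γ = fun s : ℝ ↦ g (γ 0) + s • u := by
    ext1 s
    rw [← hgX, h.timeOneMap_curve hγ, add_zero, Function.comp_apply]
  have h3 : HasDerivAt (fun s : ℝ ↦ g (γ 0) + s • u) u 0 := by
    simpa using ((hasDerivAt_id (0 : ℝ)).smul_const u).const_add (g (γ 0))
  exact h1.unique (h2 ▸ h3)

end Symplectic

/-! ### The part of the form that comes from the base -/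

section BaseForm

variable {n : ℕ}

theorem DeRham.exists_primitive {k : ℕ} {B : TopologicalSpace.Opens (RSpace n)}
    (hH : Subsingleton (DeRham.cohomology (k + 1) B))
    {τ : RSpace n → RSpace n [⋀^Fin (k + 1)]→L[ℝ] ℝ} (hτ : ContDiffOn ℝ ∞ τ B)
    (hclosed : ∀ b ∈ B, extDeriv τ b = 0) :
    ∃ η : RSpace n → RSpace n [⋀^Fin k]→L[ℝ] ℝ,
      ContDiffOn ℝ ∞ η B ∧ ∀ b ∈ B, τ b = extDeriv η b := by
  let a : DeRham.closedForms (k + 1) B := ⟨τ, hτ, hclosed⟩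
  have h : a ∈ ((DeRham.exactForms (k + 1) B).submoduleOf
      (DeRham.closedForms (k + 1) B)).toAddSubgroup :=
    (QuotientAddGroup.eq_zero_iff a).1 (Subsingleton.elim _ _)
  exact h

theorem ContinuousAlternatingMap.apply_one_eq_sum (q : RSpace n [⋀^Fin 1]→L[ℝ] ℝ) (β : RSpace n) :
    q ![β] = ∑ i, β i * q ![EuclideanSpace.single i 1] := by
  let L : RSpace n →ₗ[ℝ] ℝ :=
    { toFun := fun v ↦ q ![v]
      map_add' := fun v v' ↦ q.toContinuousMultilinearMap.cons_add ![] v v'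
      map_smul' := fun c v ↦ q.toContinuousMultilinearMap.cons_smul ![] c v }
  have hβ : ∑ i, β i • EuclideanSpace.single i (1 : ℝ) = β := by
    ext j
    simp [Finset.sum_apply, Pi.single_apply]
  have h : L β = ∑ i, β i * L (EuclideanSpace.single i 1) := by
    rw [← congrArg L hβ, _root_.map_sum]
    exact Finset.sum_congr rfl fun i _ ↦ L.map_smul _ _
  exact h

/-- A closed 2-form `α` on `B × ℝⁿ` for which the fibers are Lagrangian, in coordinates in which
the pairing with the fibers is the standard one, differs from the standard form by the exterior
derivative of a 1-form on `B`, if `H²(B) = 0`. -/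
theorem exists_base_primitive {B : TopologicalSpace.Opens (RSpace n)}
    (hH2 : Subsingleton (DeRham.cohomology 2 B))
    {α : RSpace n × RSpace n → (RSpace n × RSpace n) [⋀^Fin 2]→L[ℝ] ℝ}
    (hα : ContDiffOn ℝ ∞ α ((B : Set (RSpace n)) ×ˢ univ))
    (hclosed : ∀ z ∈ (B : Set (RSpace n)) ×ˢ univ, extDeriv α z = 0)
    (hfib : ∀ z ∈ (B : Set (RSpace n)) ×ˢ univ, ∀ (u : RSpace n) (w : RSpace n × RSpace n),
      α z ![(0, u), w] = ∑ i, u i * w.1 i) :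
    ∃ θ : RSpace n → RSpace n, ContDiffOn ℝ ∞ θ B ∧ ∀ b ∈ B, ∀ t β β' : RSpace n,
      α (b, t) ![(β, 0), (β', 0)]
        = ∑ i, (β' i * fderiv ℝ θ b β i - β i * fderiv ℝ θ b β' i) := by
  have hopen : IsOpen ((B : Set (RSpace n)) ×ˢ (univ : Set (RSpace n))) := B.isOpen.prod isOpen_univ
  have hαd {z} (hz : z ∈ (B : Set (RSpace n)) ×ˢ (univ : Set (RSpace n))) :
      DifferentiableAt ℝ α z := (hα.contDiffAt (hopen.mem_nhds hz)).differentiableAt (by simp)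
  have hconst {b : RSpace n} (hb : b ∈ B) (β β' t : RSpace n) :
      α (b, t) ![(β, 0), (β', 0)] = α (b, 0) ![(β, 0), (β', 0)] := by
    let A : RSpace n × RSpace n → ℝ := fun z ↦ α z ![(β, 0), (β', 0)]
    have hA {z} (hz : z ∈ (B : Set (RSpace n)) ×ˢ (univ : Set (RSpace n))) :
        DifferentiableAt ℝ A z :=
      ((hα.continuousAlternatingMap_apply_const _).contDiffAt (hopen.mem_nhds hz)).differentiableAt
        (by simp)
    have hA' {z} (hz : z ∈ (B : Set (RSpace n)) ×ˢ (univ : Set (RSpace n))) (u : RSpace n) :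
        fderiv ℝ A z (0, u) = 0 := by
      -- Two terms of `dα` differentiate pairings with the vertical vector `(0, u)`, which are
      -- constant by `hfib`. The remaining term is the vertical derivative of the horizontal part,
      -- which therefore vanishes.
      have h1 := extDeriv_two_apply (hαd hz) (0, u) (β, 0) (β', 0)
      have hc (w : RSpace n × RSpace n) :
          fderiv ℝ (fun y ↦ α y ![((0, u) : RSpace n × RSpace n), w]) z = 0 := by
        have h2 : (fun y ↦ α y ![((0, u) : RSpace n × RSpace n), w])
            =ᶠ[𝓝 z] fun _ ↦ ∑ i, u i * w.1 i := by
          filter_upwards [hopen.mem_nhds hz] with y hy using hfib y hy u w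
        rw [h2.fderiv_eq]
        exact fderiv_const_apply _
      rw [hclosed z hz, hc, hc] at h1
      simpa using h1.symm
    have hz (s : RSpace n) : (b, s) ∈ (B : Set (RSpace n)) ×ˢ (univ : Set (RSpace n)) :=
      ⟨hb, mem_univ s⟩
    have hline (s : RSpace n) : HasFDerivAt (fun s : RSpace n ↦ A (b, s))
        ((fderiv ℝ A (b, s)).comp (ContinuousLinearMap.inr ℝ (RSpace n) (RSpace n))) s :=
      (hA (hz s)).hasFDerivAt.comp s (hasFDerivAt_prodMk_right b s)
    refine is_const_of_fderiv_eq_zero (𝕜 := ℝ) (f := fun s : RSpace n ↦ A (b, s))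
      (fun s ↦ (hline s).differentiableAt) (fun s ↦ ?_) t 0
    rw [(hline s).fderiv]
    ext u
    exact hA' (hz s) u
  -- The horizontal part, being constant along the fibers, is the pullback of `α` by the zero
  -- section, a closed form on `B`.
  let ι : RSpace n → RSpace n × RSpace n := fun b ↦ (b, 0)
  have hι : ContDiff ℝ ∞ ι := by fun_prop
  have hι' (b : RSpace n) :
      fderiv ℝ ι b = ContinuousLinearMap.inl ℝ (RSpace n) (RSpace n) :=
    (hasFDerivAt_prodMk_left b (0 : RSpace n)).fderiv
  have hmaps : MapsTo ι B ((B : Set (RSpace n)) ×ˢ univ) := fun b hb ↦ ⟨hb, mem_univ _⟩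
  obtain ⟨η, hη, hτη⟩ := DeRham.exists_primitive hH2
    (contDiffOn_pullback B.isOpen hα hι.contDiffOn hmaps) (fun b hb ↦ by
      rw [extDeriv_pullback (hαd (hmaps hb)) hι.contDiffAt minSmoothness_two_le_infty,
        hclosed _ (hmaps hb)]
      ext v
      rfl)
  have hηc (i : Fin n) := hη.continuousAlternatingMap_apply_const ![EuclideanSpace.single i (1 : ℝ)]
  -- The coefficients of the primitive: `η = ∑ θᵢ dbᵢ`.
  let θ : RSpace n → RSpace n := fun b ↦ WithLp.toLp 2 fun i ↦ η b ![EuclideanSpace.single i 1]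
  have hθ : ContDiffOn ℝ ∞ θ B := contDiffOn_euclidean.2 fun i ↦ hηc i
  refine ⟨θ, hθ, fun b hb t β β' ↦ ?_⟩
  have hBb := B.isOpen.mem_nhds hb
  have hθd : DifferentiableAt ℝ θ b := (hθ.contDiffAt hBb).differentiableAt (by simp)
  have hfd (β v : RSpace n) : fderiv ℝ (fun y ↦ η y ![β]) b v = ∑ i, β i * fderiv ℝ θ b v i := by
    have h1 : HasFDerivAt (fun y ↦ ∑ i, β i * θ y i)
        (∑ i, β i • (EuclideanSpace.proj i : RSpace n →L[ℝ] ℝ).comp (fderiv ℝ θ b)) b := by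
      refine HasFDerivAt.fun_sum fun i _ ↦ HasFDerivAt.const_mul ?_ (β i)
      exact (EuclideanSpace.proj i : RSpace n →L[ℝ] ℝ).hasFDerivAt.comp b hθd.hasFDerivAt
    have h2 : (fun y ↦ η y ![β]) = fun y ↦ ∑ i, β i * θ y i :=
      funext fun y ↦ (η y).apply_one_eq_sum β
    rw [h2, h1.fderiv]
    simp
  have h1 := congrArg (fun q ↦ q ![β, β']) (hτη b hb)
  simp only [hι'] at h1
  rw [hconst hb, Finset.sum_sub_distrib, ← hfd, ← hfd,
    ← extDeriv_one_apply ((hη.contDiffAt hBb).differentiableAt (by simp))]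
  exact (ContinuousAlternatingMap.compContinuousLinearMap_two _ _ _ _).symm.trans h1

end BaseForm

/-! ### Pullbacks of the symplectic form -/

namespace Symplectic

variable {m : ℕ} {M : Type*} [TopologicalSpace M] [ChartedSpace (RSpace m) M]
  {W : Type*} [NormedAddCommGroup W] [NormedSpace ℝ W]

/-- The pullback of a 2-form by a map from a vector space. -/
def pullbackForm (Ω : TwoForm m M) (σ : W → M) (y : W) : W [⋀^Fin 2]→L[ℝ] ℝ :=
  (Ω (σ y)).compContinuousLinearMap (mfderiv 𝓘(ℝ, W) (𝓡 m) σ y)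

theorem pullbackForm_apply (Ω : TwoForm m M) (σ : W → M) (y v w : W) :
    pullbackForm Ω σ y ![v, w] =
      Ω (σ y) ![mfderiv 𝓘(ℝ, W) (𝓡 m) σ y v, mfderiv 𝓘(ℝ, W) (𝓡 m) σ y w] :=
  ContinuousAlternatingMap.compContinuousLinearMap_two _ _ _ _

variable [IsManifold (𝓡 m) ∞ M]

/-- Smoothness and closedness of `Ω` are expressed in charts. Writing `σ` near `y₀` as the inverse
chart after `φ = c ∘ σ` reduces them for the pullback to facts about forms on vector spaces. -/
theorem exists_pullbackForm_eq_chartForm (Ω : TwoForm m M) {σ : W → M} {s : Set W} (hs : IsOpen s)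
    (hσ : ContMDiffOn 𝓘(ℝ, W) (𝓡 m) ∞ σ s) {y₀ : W} (hy₀ : y₀ ∈ s) :
    ∃ (U : Set W) (φ : W → RSpace m), IsOpen U ∧ y₀ ∈ U ∧ ContDiffOn ℝ ∞ φ U ∧
      MapsTo φ U (extChartAt (𝓡 m) (σ y₀)).target ∧ ∀ y ∈ U, pullbackForm Ω σ y
        = (chartForm Ω (σ y₀) (φ y)).compContinuousLinearMap (fderiv ℝ φ y) := by
  let c := chartAt (RSpace m) (σ y₀)
  have hcd := mdifferentiable_chartAt (m := m) (σ y₀)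
  have htarget : (extChartAt (𝓡 m) (σ y₀)).target = c.target := by
    simp only [extChartAt, mfld_simps]
    rfl
  have hU : IsOpen (s ∩ σ ⁻¹' c.source) := hσ.continuousOn.isOpen_inter_preimage hs c.open_source
  have hφ : ContMDiffOn 𝓘(ℝ, W) 𝓘(ℝ, RSpace m) ∞ (c ∘ σ) (s ∩ σ ⁻¹' c.source) :=
    (contMDiffOn_chart (I := 𝓡 m) (n := ∞) (x := σ y₀)).comp (hσ.mono inter_subset_left)
      fun y hy ↦ hy.2
  refine ⟨s ∩ σ ⁻¹' c.source, c ∘ σ, hU, ⟨hy₀, mem_chart_source _ _⟩, hφ.contDiffOn,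
    htarget ▸ fun y hy ↦ c.map_source hy.2, fun y hy ↦ ?_⟩
  have hσd : MDifferentiableAt 𝓘(ℝ, W) (𝓡 m) σ y :=
    (hσ.contMDiffAt (hs.mem_nhds hy.1)).mdifferentiableAt (by simp)
  have hcy := hcd.mdifferentiableAt hy.2
  have h1 := HasMFDerivAt.comp (I := 𝓘(ℝ, W)) (I' := 𝓡 m) (I'' := 𝓘(ℝ, RSpace m)) y
    hcy.hasMFDerivAt hσd.hasMFDerivAt
  let D : W →L[ℝ] RSpace m := mfderiv 𝓘(ℝ, W) (𝓡 m) σ y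
  let C : RSpace m →L[ℝ] RSpace m := mfderiv (𝓡 m) 𝓘(ℝ, RSpace m) c (σ y)
  let S : RSpace m →L[ℝ] RSpace m := mfderiv 𝓘(ℝ, RSpace m) (𝓡 m) c.symm (c (σ y))
  have hfd : fderiv ℝ (c ∘ σ) y = C.comp D := by
    have h2 : HasFDerivAt (c ∘ σ) (C.comp D) y := hasMFDerivAt_iff_hasFDerivAt.1 h1
    exact h2.fderiv
  have hSC (v : RSpace m) : S (C v) = v :=
    congrArg (fun l ↦ l v) (hcd.symm_comp_deriv hy.2)
  -- With arguments in the fixed space `RSpace m`, the base point can be rewritten without dependent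
  -- types interfering.
  let A : M → RSpace m → RSpace m → ℝ := fun x v w ↦ Ω x ![v, w]
  ext v
  have hv : v = ![v 0, v 1] := by ext i; fin_cases i <;> rfl
  rw [hv, hfd]
  have e1 : pullbackForm Ω σ y ![v 0, v 1] = A (σ y) (D (v 0)) (D (v 1)) :=
    pullbackForm_apply _ _ _ _ _
  have e2 : (chartForm Ω (σ y₀) ((c ∘ σ) y)).compContinuousLinearMap (C.comp D) ![v 0, v 1]
      = A (c.symm (c (σ y))) (S (C (D (v 0)))) (S (C (D (v 1)))) :=
    (ContinuousAlternatingMap.compContinuousLinearMap_two _ _ _ _).trans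
      (ContinuousAlternatingMap.compContinuousLinearMap_two _ _ _ _)
  rw [e1, e2, hSC, hSC, c.left_inv hy.2]

theorem IsSymplecticForm.contDiffOn_pullbackForm [FiniteDimensional ℝ W] {Ω : TwoForm m M} (hΩ : IsSymplecticForm Ω)
    {σ : W → M} {s : Set W} (hs : IsOpen s) (hσ : ContMDiffOn 𝓘(ℝ, W) (𝓡 m) ∞ σ s) :
    ContDiffOn ℝ ∞ (pullbackForm Ω σ) s := by
  intro y hy
  obtain ⟨U, φ, hU, hyU, hφ, hmaps, heq⟩ := exists_pullbackForm_eq_chartForm Ω hs hσ hy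
  exact (((contDiffOn_pullback hU (hΩ.smooth (σ y)) hφ hmaps).congr heq).contDiffAt
    (hU.mem_nhds hyU)).contDiffWithinAt

theorem IsSymplecticForm.extDeriv_pullbackForm {Ω : TwoForm m M} (hΩ : IsSymplecticForm Ω)
    {σ : W → M} {s : Set W} (hs : IsOpen s) (hσ : ContMDiffOn 𝓘(ℝ, W) (𝓡 m) ∞ σ s) {y : W}
    (hy : y ∈ s) : extDeriv (pullbackForm Ω σ) y = 0 := by
  obtain ⟨U, φ, hU, hyU, hφ, hmaps, heq⟩ := exists_pullbackForm_eq_chartForm Ω hs hσ hy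
  have h1 : pullbackForm Ω σ =ᶠ[𝓝 y] fun y' ↦
      (chartForm Ω (σ y) (φ y')).compContinuousLinearMap (fderiv ℝ φ y') := by
    filter_upwards [hU.mem_nhds hyU] with y' hy' using heq y' hy'
  have h2 : DifferentiableAt ℝ (chartForm Ω (σ y)) (φ y) :=
    ((hΩ.smooth (σ y)).contDiffAt ((isOpen_extChartAt_target _).mem_nhds
      (hmaps hyU))).differentiableAt (by simp)
  rw [h1.extDeriv_eq, extDeriv_pullback h2 (hφ.contDiffAt (hU.mem_nhds hyU))
    minSmoothness_two_le_infty, hΩ.closed _ _ (hmaps hyU)]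
  ext v
  rfl

end Symplectic

/-! ### Correction to Darboux coordinates -/

namespace Symplectic

variable {n : ℕ} {M : Type*} [TopologicalSpace M] [ChartedSpace (RSpace (2 * n)) M]
  [IsManifold (𝓡 (2 * n)) ∞ M] {Ω : TwoForm (2 * n) M} {f g : M → RSpace n}

/-- Fiber coordinates `g` that are conjugate to `f` along the fibers can be corrected by a function
on the base to global Darboux coordinates. -/
theorem exists_isGlobalDarbouxCoordinateSystem [Nonempty M] (hΩ : IsSymplecticForm Ω)
    (hf : ContMDiff (𝓡 (2 * n)) (𝓡 n) ∞ f) (hlag : HasLagrangianFibers Ω f)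
    (hindep : ∀ x, LinearIndependent ℝ fun i ↦ hamiltonianVectorField Ω (fun y ↦ f y i) x)
    {B : TopologicalSpace.Opens (RSpace n)} (hH2 : Subsingleton (DeRham.cohomology 2 B))
    (hg : ContMDiff (𝓡 (2 * n)) (𝓡 n) ∞ g)
    (hgX : ∀ x u, vectorDifferential (2 * n) g x (hamiltonianCombination Ω f u x) = u)
    (hinj : Function.Injective fun x ↦ (f x, g x))
    (hrange : range (fun x ↦ (f x, g x)) = (B : Set (RSpace n)) ×ˢ univ) :
    ∃ g' : M → RSpace n, IsGlobalDarbouxCoordinateSystem Ω f g' := by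
  have hfd (x : M) : MDifferentiableAt (𝓡 (2 * n)) 𝓘(ℝ, RSpace n) f x :=
    (hf x).mdifferentiableAt (by simp)
  have hgd (x : M) : MDifferentiableAt (𝓡 (2 * n)) 𝓘(ℝ, RSpace n) g x :=
    (hg x).mdifferentiableAt (by simp)
  have hfB (x : M) : f x ∈ B := by
    have h : (f x, g x) ∈ (B : Set (RSpace n)) ×ˢ (univ : Set (RSpace n)) := hrange ▸ mem_range_self x
    exact h.1
  obtain ⟨e, hes, heφ, hesm, hesymm⟩ := isGlobalCoordinateSystem_of_bijective_mfderiv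
    (φ := fun x ↦ (f x, g x)) (hf.prodMk_space hg) hinj fun x ↦
      bijective_vectorDifferential_prodMk hΩ hf hlag (hindep x) (hgd x) one_ne_zero
        fun u ↦ by rw [hgX, one_smul]
  have hetarget : e.target = (B : Set (RSpace n)) ×ˢ univ := by
    rw [← hrange, ← e.image_source_eq_target, hes, image_univ]
    exact congrArg range (funext heφ)
  have hed : e.MDifferentiable (𝓡 (2 * n)) 𝓘(ℝ, RSpace n × RSpace n) :=
    ⟨hesm.mdifferentiable (by simp) |>.mdifferentiableOn, hesymm.mdifferentiableOn (by simp)⟩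
  have hsource (x : M) : x ∈ e.source := hes ▸ mem_univ x
  have hDe (x : M) (v : TangentSpace (𝓡 (2 * n)) x) : vectorDifferential (2 * n) e x v
      = (vectorDifferential (2 * n) f x v, vectorDifferential (2 * n) g x v) := by
    rw [← mfderiv_prodMk_vector (hfd x) (hgd x)]
    exact congrArg (fun φ : M → RSpace n × RSpace n ↦
      (mfderiv (𝓡 (2 * n)) 𝓘(ℝ, RSpace n × RSpace n) φ x v : RSpace n × RSpace n)) (funext heφ)
  let α := pullbackForm Ω e.symm
  have hα (x : M) (v w : TangentSpace (𝓡 (2 * n)) x) : α (e x)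
      ![vectorDifferential (2 * n) e x v, vectorDifferential (2 * n) e x w] = Ω x ![v, w] := by
    let A : M → RSpace (2 * n) → RSpace (2 * n) → ℝ := fun x v w ↦ Ω x ![v, w]
    let S : RSpace n × RSpace n → RSpace (2 * n) :=
      mfderiv 𝓘(ℝ, RSpace n × RSpace n) (𝓡 (2 * n)) e.symm (e x)
    have hS (v : TangentSpace (𝓡 (2 * n)) x) : S (vectorDifferential (2 * n) e x v) = v :=
      congrArg (fun l ↦ l v) (hed.symm_comp_deriv (hsource x))
    have h1 : α (e x) ![vectorDifferential (2 * n) e x v, vectorDifferential (2 * n) e x w]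
      = A (e.symm (e x)) (S (vectorDifferential (2 * n) e x v))
        (S (vectorDifferential (2 * n) e x w)) := pullbackForm_apply _ _ _ _ _
    rw [h1, hS, hS, e.left_inv (hsource x)]
  -- `(0, u)` is the image of `X u`, so this is the defining relation of the Hamiltonian fields in
  -- the coordinates `(f, g)`.
  have hfib' (x : M) (u : RSpace n) (w : RSpace n × RSpace n) :
      α (e x) ![(0, u), w] = ∑ i, u i * w.1 i := by
    obtain ⟨w', hw'⟩ := (bijective_vectorDifferential_prodMk hΩ hf hlag (hindep x) (hgd x)
      one_ne_zero fun u ↦ by rw [hgX, one_smul]).2 w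
    have hw : vectorDifferential (2 * n) e x w' = w :=
      (hDe x w').trans ((mfderiv_prodMk_vector (hfd x) (hgd x) w').symm.trans hw')
    have hu : vectorDifferential (2 * n) e x (hamiltonianCombination Ω f u x) = (0, u) := by
      rw [hDe, hgX]
      exact congrArg (fun w ↦ (w, u)) (mfderiv_hamiltonianCombination hΩ hf hlag u x)
    have h := hα x (hamiltonianCombination Ω f u x) w'
    rw [hu, apply_hamiltonianCombination hΩ hf] at h
    rw [← hw]
    refine h.trans ?_
    rw [hDe]
  obtain ⟨θ, hθ, hαθ⟩ := exists_base_primitive hH2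
    (hetarget ▸ hΩ.contDiffOn_pullbackForm e.open_target hesymm)
    (hetarget ▸ fun z hz ↦ hΩ.extDeriv_pullbackForm e.open_target hesymm hz)
    (fun z hz u w ↦ by
      rw [← hetarget] at hz
      have h := hfib' (e.symm z) u w
      rwa [e.right_inv hz] at h)
  have hθf : ContMDiff (𝓡 (2 * n)) (𝓡 n) ∞ (θ ∘ f) := fun x ↦
    ContMDiffAt.comp x (hθ.contDiffAt (B.isOpen.mem_nhds (hfB x))).contMDiffAt (hf x)
  have hθfd (x : M) (v : TangentSpace (𝓡 (2 * n)) x) : vectorDifferential (2 * n) (θ ∘ f) x v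
      = fderiv ℝ θ (f x) (vectorDifferential (2 * n) f x v) := by
    have h1 : DifferentiableAt ℝ θ (f x) :=
      (hθ.contDiffAt (B.isOpen.mem_nhds (hfB x))).differentiableAt (by simp)
    have h2 := HasMFDerivAt.comp (I := 𝓡 (2 * n)) (I' := 𝓘(ℝ, RSpace n)) (I'' := 𝓘(ℝ, RSpace n)) x
      h1.hasFDerivAt.hasMFDerivAt (hfd x).hasMFDerivAt
    exact congrArg (fun l ↦ l v) h2.mfderiv
  -- The sign comes from the convention `Ω (𝕏_h, ·) = dh`: in Darboux coordinates for `∑ dfᵢ ∧ dgᵢ`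
  -- the field `𝕏_{fᵢ}` is `-∂/∂gᵢ`, whereas `g` increases along it.
  let g' : M → RSpace n := fun x ↦ -(g x + (θ ∘ f) x)
  have hg' : ContMDiff (𝓡 (2 * n)) (𝓡 n) ∞ g' := (hg.add hθf).neg
  have hg'd (x : M) (v : TangentSpace (𝓡 (2 * n)) x) : vectorDifferential (2 * n) g' x v
      = -(vectorDifferential (2 * n) g x v
        + fderiv ℝ θ (f x) (vectorDifferential (2 * n) f x v)) := by
    rw [← hθfd]
    have h1 := ((hgd x).hasMFDerivAt.add
      ((hθf x).mdifferentiableAt (by simp)).hasMFDerivAt).neg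
    exact congrArg (fun l ↦ l v) h1.mfderiv
  refine ⟨g', ?_, fun x v w ↦ ?_⟩
  · refine isGlobalCoordinateSystem_of_bijective_mfderiv (φ := fun x ↦ (f x, g' x))
      (hf.prodMk_space hg') (fun x y hxy ↦ hinj ?_) fun x ↦
      bijective_vectorDifferential_prodMk hΩ hf hlag (hindep x)
        ((hg' x).mdifferentiableAt (by simp)) (neg_ne_zero.2 one_ne_zero) fun u ↦ ?_
    · obtain ⟨h1, h2⟩ := Prod.ext_iff.1 hxy
      have h3 : g x + θ (f x) = g y + θ (f y) := neg_injective h2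
      have h4 : f x = f y := h1
      rw [h4] at h3
      exact Prod.ext h1 (add_right_cancel h3)
    · have h1 : vectorDifferential (2 * n) f x (hamiltonianCombination Ω f u x) = 0 :=
        mfderiv_hamiltonianCombination hΩ hf hlag u x
      rw [hg'd, hgX, h1, map_zero, add_zero, neg_smul, one_smul]
  · simp only [differential_apply hf, differential_apply hg', hg'd]
    rw [← hα, hDe, hDe]
    generalize hβ : (vectorDifferential (2 * n) f x v : RSpace n) = β
    generalize hβ' : (vectorDifferential (2 * n) f x w : RSpace n) = β'
    generalize hu : (vectorDifferential (2 * n) g x v : RSpace n) = u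
    generalize hu' : (vectorDifferential (2 * n) g x w : RSpace n) = u'
    have h1 := hfib' x u (β', u')
    have h2 := hfib' x u' (β, 0)
    have h3 := hαθ (f x) (hfB x) (g x) β β'
    have h4 : (f x, g x) = e x := (heφ x).symm
    rw [h4] at h3
    -- The first two terms involve a vertical vector and are given by `hfib'`; the purely horizontal
    -- one is given by `θ`.
    have h5 : α (e x) ![(β, u), (β', u')] = α (e x) ![(0, u), (β', u')]
        - α (e x) ![(0, u'), (β, 0)] + α (e x) ![(β, 0), (β', 0)] := by
      have hsplit (a r : RSpace n) (z : RSpace n × RSpace n) :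
          α (e x) ![(a, r), z] = α (e x) ![(0, r), z] + α (e x) ![(a, 0), z] := by
        rw [← ContinuousAlternatingMap.apply_two_add, Prod.mk_add_mk, zero_add, add_zero]
      rw [hsplit β u, (α (e x)).apply_swap (β, 0), hsplit β' u', (α (e x)).apply_swap (β', 0)]
      ring
    rw [h5, h1, h2]
    refine (congrArg (fun r ↦ (∑ i, u i * β' i) - (∑ i, u' i * β i) + r) h3).trans ?_
    rw [← Finset.sum_sub_distrib, ← Finset.sum_add_distrib]
    refine Finset.sum_congr rfl fun i _ ↦ ?_
    simp only [PiLp.neg_apply, PiLp.add_apply]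
    ring

end Symplectic

end

/-! ### The theorem -/

theorem theorem3p11 {n k : ℕ}
    {M : Type*} [TopologicalSpace M] [T2Space M] [SecondCountableTopology M]
    [ChartedSpace (RSpace (2 * n)) M] [IsManifold (𝓡 (2 * n)) ∞ M]
    {F : Type*} [TopologicalSpace F] [ChartedSpace (RSpace k) F] [IsManifold (𝓡 k) ∞ F]
    (Ω : Symplectic.TwoForm (2 * n) M) (hΩ : Symplectic.IsSymplecticForm Ω)
    (B : TopologicalSpace.Opens (RSpace n)) (hB : IsConnected (B : Set (RSpace n)))
    (hH2 : Subsingleton (DeRham.cohomology 2 B))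
    (f : M → RSpace n) (hf : Symplectic.IsSmoothFiberBundle (m := 2 * n) k F f B)
    (hsimply : ∀ b ∈ B, SimplyConnectedSpace (f ⁻¹' {b}))
    (hlagrangian : Symplectic.HasLagrangianFibers Ω f)
    (hindep : ∀ x : M, LinearIndependent ℝ
      (fun i : Fin n ↦ Symplectic.hamiltonianVectorField Ω (fun y ↦ f y i) x))
    (hcomplete : ∀ i : Fin n, Symplectic.IsCompleteVectorField
      (Symplectic.hamiltonianVectorField Ω (fun y ↦ f y i))) :
    ∃ g : M → RSpace n, Symplectic.IsGlobalDarbouxCoordinateSystem Ω f g := by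
  open Symplectic Set in
  have h : IsFlatFibration f (hamiltonianCombination Ω f) :=
    ⟨hamiltonianCombination_smul,
      exists_isFlatChart hΩ hf.contMDiff hlagrangian hindep⟩
  have hc : ∀ u, IsCompleteVectorField (hamiltonianCombination Ω f u) := h.isComplete fun i ↦ by
    have h1 : hamiltonianCombination Ω f (EuclideanSpace.single i 1)
        = hamiltonianVectorField Ω (fun y ↦ f y i) := funext (hamiltonianCombination_single i)
    exact h1 ▸ hcomplete i
  have hsurj (b : RSpace n) (hb : b ∈ B) : ∃ x, f x = b := by
    have := hsimply b hb
    obtain ⟨x⟩ := (inferInstance : Nonempty (f ⁻¹' {b}))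
    exact ⟨x, x.2⟩
  have hunique (x y : M) (hxy : f y = f x) : ∃! u, timeOneMap (hamiltonianCombination Ω f u) x = y :=
    h.existsUnique_timeOneMap_eq hc (hsimply _ (hf.mapsTo x)) hxy
  obtain ⟨g, hg, hgX⟩ := h.exists_equivariant hc hunique hf.contMDiff hf.mapsTo hsurj
  obtain ⟨b, hb⟩ := hB.nonempty
  obtain ⟨p, -⟩ := hsurj b hb
  have : Nonempty M := ⟨p⟩
  refine exists_isGlobalDarbouxCoordinateSystem hΩ hf.contMDiff hlagrangian hindep hH2 hg
    (fun x u ↦ h.vectorDifferential_equivariant (hc u) (hg.mdifferentiable (by simp))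
      (fun s x ↦ hgX _ x) x) (fun x y hxy ↦ ?_) (Subset.antisymm ?_ ?_)
  · obtain ⟨h1, h2⟩ := Prod.ext_iff.1 hxy
    -- Points with the same `f` differ by the flow of some `X u`, which changes `g` by `u`; equal
    -- values of `g` force `u = 0`.
    obtain ⟨u, hu, -⟩ := hunique x y h1.symm
    have h3 : g y = g x + u := hu ▸ hgX u x
    have h4 : u = 0 := by
      have h5 : g x = g y := h2
      rw [h5] at h3
      exact left_eq_add.1 h3
    rw [h4, h.timeOneMap_zero] at hu
    exact hu
  · rintro _ ⟨x, rfl⟩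
    exact ⟨hf.mapsTo x, mem_univ _⟩
  · rintro ⟨b, t⟩ ⟨hb, -⟩
    obtain ⟨x, rfl⟩ := hsurj b hb
    -- Flowing by `t - g x` inside the fiber moves the value of `g` from `g x` to `t`.
    refine ⟨timeOneMap (hamiltonianCombination Ω f (t - g x)) x, Prod.ext ?_ ?_⟩
    · exact h.apply_timeOneMap (hc _) x
    · exact (hgX _ x).trans (add_sub_cancel _ _)
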